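/- Let $S^1$ be the circle of length $2\pi$, $X=L^2(S^1;\mathbb R)$ with $\langle f,g\rangle=\int_0^{2\pi} f g\,d\theta$, $X^+=\{y\in X: y\ge 0 \text{ a.e.}\}$ and $X^+_0=X^+\setminus\{0\}$. Let $A,N$ be bounded measurable functions on $S^1$ with $N\ge 0$ and $N$ not a.e. zero, and let $\rho>0$, $\sigma\in(0,1)\cup(1,\infty)$. Let $\mathcal A f=f''+Af$ with domain $W^{2,2}(S^1)$, let $(e^{t\mathcal A})_{t\ge0}$ be the $C_0$-semigroup on $X$ generated by $\mathcal A$, let $\lambda_0$ be the largest eigenvalue of $\mathcal A$ and $e_0\ge 0$, $|e_0|=1$, the corresponding principal eigenfunction. For $x\in X$ and $u\in L^1_{\rm loc}(\mathbb R^+;X)$ let $$y^{x,u}(t)=e^{t\mathcal A}x-\int_0^t e^{(t-r)\mathcal A}\big(u(r)N\big)\,dr ,$$ the mild solution of $y'=\mathcal A y-uN$, $y(0)=x$. Let $$\mathcal U(x)=\{u\in L^1_{\rm loc}(\mathbb R^+;X^+): y^{x,u}(t)\in X^+_0\ \ \forall t\ge 0\},$$ $$J(x;u)=\int_0^\infty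 e^{-\rho t}\int_0^{2\pi}\frac{u(t)(\theta)^{1-\sigma}}{1-\sigma}N(\theta)\,d\theta\,dt\in[-\infty,\infty],\qquad V(x)=\sup_{u\in\mathcal U(x)}J(x;u).$$ A measurable map $\phi:X\to X$ with $\phi(X^+_0)\subseteq X^+$ is an optimal feedback at $x$ if the closed loop equation $y'=\mathcal A y-\phi(y)N$, $y(0)=x$, has a unique mild solution $y$ in $C([0,\infty);X)$, this solution takes values in $X_0^+$, and $t\mapsto\phi(y(t))$ belongs to $\mathcal U(x)$ and is optimal, i.e. maximizes $J(x;\cdot)$ over $\mathcal U(x)$. Assume $\rho>\lambda_0(1-\sigma)$ and put $$\alpha_0=\Big(\frac{\sigma}{\rho-\lambda_0(1-\sigma)}\int_{S^1}e_0^{\,1-\frac1\sigma}N\,d\eta\Big)^{\frac{\sigma}{1-\sigma}},\qquad \beta=\alpha_0e_0,\qquad v(x)=\frac{\langle x,\beta\rangle^{1-\sigma}}{1-\sigma},\qquad \phi(y)=\langle y,\beta\rangle\,\beta^{-1/\sigma}.$$ **Theorem.** We have $\beta>0$ a.e. and $\beta^{-1/\sigma}\in X$. Let $x\in X^+_0$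 and let $y^*\in C([0,\infty);X)$ be the mild solution of the closed loop equation $y'=\mathcal A y-\langle y,\beta\rangle\beta^{-1/\sigma}N$, $y(0)=x$. If $y^*(t)\in X^+_0$ for all $t\ge 0$, then $y^*$ is the unique mild solution, the control $u^*(t)=\phi(y^*(t))$ belongs to $\mathcal U(x)$ and is optimal at $x$, $\phi$ is an optimal feedback at $x$, and $V(x)=v(x)$. -/

import Mathlib

open MeasureTheory Set Filter Topology Real
open scoped ENNReal InnerProductSpace

noncomputable section

namespace SpatialGrowth

instance factTwoPiPos : Fact (0 < 2 * π) := ⟨Real.two_pi_pos⟩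

/-- The unit circle, parametrised by the angle, with the measure `dθ` of total mass `2π`. -/
abbrev S1 : Type := AddCircle (2 * π)

/-- The state and control space `L²(S¹; ℝ)`. -/
abbrev X : Type := Lp ℝ 2 (volume : Measure S1)

/-- Bounded measurable coefficients on the circle, `L^∞(S¹; ℝ)`.
For `a : Coeff` and `f : X`, `a • f : X` is the pointwise product. -/
abbrev Coeff : Type := Lp ℝ ∞ (volume : Measure S1)

/-- `g` is the weak derivative of `f` on the circle: the test functions are the smooth functions
on `S¹`, that is, the smooth `2π`-periodic functions on the line. -/
def HasWeakDeriv (f g : X) : Prop :=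
  ∀ φ : ℝ → ℝ, ContDiff ℝ (⊤ : ℕ∞) φ → Function.Periodic φ (2 * π) →
    ∫ θ in (0 : ℝ)..(2 * π), f (θ : S1) * deriv φ θ
      = - ∫ θ in (0 : ℝ)..(2 * π), g (θ : S1) * φ θ

/-- The graph of the operator `𝒜 f = f'' + A f` with domain `W^{2,2}(S¹)`:
`f` has weak derivatives `f'`, `f''` in `L²(S¹)` and `g = f'' + A f`. -/
def OpGraph (A : Coeff) (f g : X) : Prop :=
  ∃ f' f'' : X, HasWeakDeriv f f' ∧ HasWeakDeriv f' f'' ∧ g = f'' + (A • f : X)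

/-- `S` (restricted to times `t ≥ 0`) is a strongly continuous semigroup on `X`. -/
structure IsC0Semigroup (S : ℝ → X →L[ℝ] X) : Prop where
  zero : S 0 = ContinuousLinearMap.id ℝ X
  add : ∀ s t : ℝ, 0 ≤ s → 0 ≤ t → S (s + t) = (S s).comp (S t)
  tendsto : ∀ x : X, Tendsto (fun t => S t x) (𝓝[>] 0) (𝓝 x)

/-- `S` is a `C₀`-semigroup whose infinitesimal generator is exactly the operator `𝒜`
(same domain, same values). -/
def IsGeneratedSemigroup (A : Coeff) (S : ℝ → X →L[ℝ] X) : Prop :=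
  IsC0Semigroup S ∧
    ∀ f g : X, Tendsto (fun t : ℝ => t⁻¹ • (S t f - f)) (𝓝[>] 0) (𝓝 g) ↔ OpGraph A f g

open Classical in
/-- The semigroup `e^{t𝒜}`, `t ≥ 0`: the `C₀`-semigroup generated by `𝒜`. Two such semigroups agree
at all `t ≥ 0`; values at negative times are never used. -/
def expA (A : Coeff) : ℝ → X →L[ℝ] X :=
  if h : ∃ S, IsGeneratedSemigroup A S then h.choose else 0

/-- `lam` is an eigenvalue of `𝒜`. -/
def IsEigenvalue (A : Coeff) (lam : ℝ) : Prop :=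
  ∃ f : X, f ≠ 0 ∧ OpGraph A f (lam • f)

/-- The principal (largest) eigenvalue `λ₀` of `𝒜`. -/
def lambda0 (A : Coeff) : ℝ := sSup {lam | IsEigenvalue A lam}

/-- `e` is the principal eigenfunction of `𝒜`: the eigenfunction for `λ₀` of unit norm, with the
sign chosen so that `e ≥ 0`. -/
structure IsPrincipalEigenfunction (A : Coeff) (e : X) : Prop where
  eigen : OpGraph A e (lambda0 A • e)
  norm_eq_one : ‖e‖ = 1
  nonneg : 0 ≤ e

/-- The cone `X⁺` of nonnegative functions. -/
def Xpos : Set X := {y | 0 ≤ y}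

/-- `X⁺₀ = X⁺ \ {0}`. -/
def Xpos0 : Set X := Xpos \ {0}

/-- The trajectory `y^{x,u}`, i.e. the mild solution of `y' = 𝒜 y - u N`, `y(0) = x`. -/
def traj (A N : Coeff) (x : X) (u : ℝ → X) (t : ℝ) : X :=
  expA A t x - ∫ r in (0 : ℝ)..t, expA A (t - r) (N • u r : X)

/-- The admissible controls at `x`: locally integrable, `X⁺`-valued, keeping the state in `X⁺₀`
at all times. Only times `t ≥ 0` matter. -/
def Admissible (A N : Coeff) (x : X) : Set (ℝ → X) :=
  {u | LocallyIntegrableOn u (Ici 0) volume ∧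
    (∀ᵐ t ∂(volume.restrict (Ici (0 : ℝ))), u t ∈ Xpos) ∧
    ∀ t : ℝ, 0 ≤ t → traj A N x u t ∈ Xpos0}

/-- `∫ u(θ)^{1-σ} N(θ) dθ ∈ [0, ∞]` for `u ∈ X⁺`, so that the instantaneous utility is
`Ψ(u) = (1-σ)⁻¹ * powerIntegral σ N u`. For `σ > 1` one has `0^{1-σ} = ∞`. -/
def powerIntegral (σ : ℝ) (N : Coeff) (u : X) : ℝ≥0∞ :=
  ∫⁻ θ, ENNReal.ofReal (u θ) ^ (1 - σ) * ENNReal.ofReal (N θ)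

/-- The objective `J(u) = ∫₀^∞ e^{-ρt} Ψ(u(t)) dt`. The integrand has constant sign (that of
`1 - σ`), so the integral always exists in `[-∞, ∞]`; the constant `(1-σ)⁻¹` stands outside. -/
def objective (ρ σ : ℝ) (N : Coeff) (u : ℝ → X) : EReal :=
  (((1 - σ)⁻¹ : ℝ) : EReal) *
    ((∫⁻ t in Ioi (0 : ℝ), ENNReal.ofReal (Real.exp (-ρ * t)) * powerIntegral σ N (u t) : ℝ≥0∞) :
      EReal)

/-- The value function `V(x)`. -/
def valueFunction (ρ σ : ℝ) (A N : Coeff) (x : X) : EReal :=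
  ⨆ u ∈ Admissible A N x, objective ρ σ N u

/-- `u` is an optimal control at `x`. -/
def IsOptimalControl (ρ σ : ℝ) (A N : Coeff) (x : X) (u : ℝ → X) : Prop :=
  u ∈ Admissible A N x ∧ ∀ w ∈ Admissible A N x, objective ρ σ N w ≤ objective ρ σ N u

/-- `y` is a mild solution of the closed loop equation `y' = 𝒜 y - φ(y) N`, `y(0) = x`. -/
def IsClosedLoopSolution (A N : Coeff) (φ : X → X) (x : X) (y : ℝ → X) : Prop :=
  ContinuousOn y (Ici 0) ∧
    ∀ t : ℝ, 0 ≤ t → y t = expA A t x - ∫ r in (0 : ℝ)..t, expA A (t - r) (N • φ (y r) : X)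

/-- A feedback map restricts to a Borel measurable map from `X⁺₀` to `X⁺`. -/
def IsFeedbackMap (φ : X → X) : Prop :=
  MapsTo φ Xpos0 Xpos ∧ @Measurable Xpos0 X (borel _) (borel _) (fun z => φ z)

/-- `φ` is a feedback map that is admissible at `x`, with closed loop trajectory `y`: the closed
loop equation has exactly one mild solution, `y`, it stays in `X⁺₀`, and the feedback control
`t ↦ φ (y t)` is admissible. -/
def IsAdmissibleFeedback (A N : Coeff) (φ : X → X) (x : X) (y : ℝ → X) : Prop :=
  IsFeedbackMap φ ∧ IsClosedLoopSolution A N φ x y ∧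
    (∀ z : ℝ → X, IsClosedLoopSolution A N φ x z → EqOn z y (Ici 0)) ∧
    (∀ t : ℝ, 0 ≤ t → y t ∈ Xpos0) ∧
    (fun t => φ (y t)) ∈ Admissible A N x

/-- `φ` is an optimal feedback at `x`. -/
def IsOptimalFeedback (ρ σ : ℝ) (A N : Coeff) (φ : X → X) (x : X) : Prop :=
  ∃ y : ℝ → X, IsAdmissibleFeedback A N φ x y ∧ IsOptimalControl ρ σ A N x (fun t => φ (y t))

/-- The constant `α₀`. -/
def alpha0 (ρ σ : ℝ) (A N : Coeff) (e₀ : X) : ℝ :=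
  (σ / (ρ - lambda0 A * (1 - σ)) * ∫ η, (e₀ η) ^ (1 - 1 / σ) * N η) ^ (σ / (1 - σ))

/-- `β = α₀ e₀`. -/
def beta (ρ σ : ℝ) (A N : Coeff) (e₀ : X) : X := alpha0 ρ σ A N e₀ • e₀

open Classical in
/-- The pointwise power `f^q` as an element of `L²(S¹)` (zero if it is not square integrable). -/
def powL2 (f : X) (q : ℝ) : X :=
  if h : MemLp (fun θ => (f θ) ^ q) 2 (volume : Measure S1) then h.toLp else 0

/-- The feedback `φ(y) = ⟨y, β⟩ β^{-1/σ}`. -/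
def feedback (ρ σ : ℝ) (A N : Coeff) (e₀ : X) (y : X) : X :=
  ⟪y, beta ρ σ A N e₀⟫_ℝ • powL2 (beta ρ σ A N e₀) (-1 / σ)

/-- The explicit solution `v(x) = ⟨x, β⟩^{1-σ} / (1-σ)` of the HJB equation. -/
def explicitValue (ρ σ : ℝ) (A N : Coeff) (e₀ : X) (x : X) : ℝ :=
  ⟪x, beta ρ σ A N e₀⟫_ℝ ^ (1 - σ) / (1 - σ)

end SpatialGrowth

end

/-!
The proof is a duality argument: it compares every control with a supporting price system, and
the Hamilton-Jacobi-Bellman equation is never differentiated along a trajectory.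

Write `l` for the principal eigenvalue and `m = ⟪x, β⟫`. On the circle a weak derivative is an
honest derivative almost everywhere (`HasWeakDeriv.exists_primitive`, by completeness of the
trigonometric system). Hence `𝒜` is symmetric (`OpGraph.inner_eq`), and a nonnegative eigenfunction
that touches zero vanishes together with its derivative there and so everywhere, by Gronwall
(`OpGraph.exists_bounds`). So `e₀`, and with it `β`, is bounded above and away from zero, which
gives the claims on `β` and on `β^{-1/σ}`.

By symmetry the pairing with `β` turns the semigroup into the scalar factor `e^{lt}`
(`IsGeneratedSemigroup.inner_eigen`). Since `⟪y(t), β⟫ ≥ 0` along an admissible trajectory, every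
admissible `u` satisfies the budget constraint `∫₀^∞ e^{-lr} ⟪N u(r), β⟫ dr ≤ m`
(`lintegral_price_le`). Young's inequality at the price `q = m^{-σ} e^{(ρ-l)t} β(θ)` bounds
`u^{1-σ}/(1-σ)` by `q u + σ/(1-σ) q^{1-1/σ}`; integrating against `e^{-ρt} N` and inserting the
budget constraint gives `J(x;u) ≤ m^{1-σ}/(1-σ) = v(x)` (`lintegral_utility_le`, `le_lintegral_utility`).
The constant `α₀` is chosen so that `K = ∫ β^{1-1/σ} N` equals `(ρ - l(1-σ))/σ`, which is also the
rate at which the dual integrand decays.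

For the closed loop equation, `⟪y(t), β⟫` solves a scalar Volterra equation, so it equals
`e^{(l-K)t} m` (`IsClosedLoopSolution.inner_eq`). The feedback sees the state only through this
number, so the mild solution is unique, and the utility of the feedback control is computed
explicitly and attains `v(x)` (`lintegral_utility_eq`).
-/

noncomputable section

namespace SpatialGrowth

/-! ### Fourier completeness and periodic primitives on the circle -/

/-- The covering map `ℝ → S¹` pulls null sets back to null sets of the whole line. -/
theorem ae_coe_of_ae {P : S1 → Prop} (h : ∀ᵐ θ : S1, P θ) : ∀ᵐ s : ℝ, P (s : S1) := by
  have h1 : ∀ n : ℤ, ∀ᵐ s : ℝ ∂(volume.restrict (Ioc (n • (2 * π)) ((n + 1) • (2 * π)))),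
      P (s : S1) := by
    intro n
    have := (AddCircle.measurePreserving_mk (2 * π) (n • (2 * π))).quasiMeasurePreserving.ae h
    rwa [add_smul, one_smul]
  have h2 := ae_restrict_iUnion_iff (μ := (volume : Measure ℝ))
    (fun n : ℤ => Ioc (n • (2 * π)) ((n + 1) • (2 * π))) (fun s : ℝ => P (s : S1))
  rw [iUnion_Ioc_zsmul Real.two_pi_pos, Measure.restrict_univ] at h2
  exact h2.2 h1

theorem ae_of_ae_coe {P : S1 → Prop} (hP : MeasurableSet {θ | P θ})
    (h : ∀ᵐ s : ℝ, P (s : S1)) : ∀ᵐ θ : S1, P θ := by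
  have hm := AddCircle.measurePreserving_mk (2 * π) 0
  rw [← hm.map_eq, ae_map_iff hm.measurable.aemeasurable hP]
  exact ae_restrict_of_ae h

theorem intervalIntegrable_comp_coe {f : S1 → ℝ} (hf : Integrable f) (a b : ℝ) :
    IntervalIntegrable (fun s : ℝ => f (s : S1)) volume a b := by
  have hp : Function.Periodic (fun s : ℝ => f (s : S1)) (2 * π) := fun s => by simp
  refine hp.intervalIntegrable (t := 0) Real.two_pi_pos.ne' ?_ a b
  rw [intervalIntegrable_iff, uIoc_of_le (by linarith [Real.two_pi_pos])]
  exact (AddCircle.measurePreserving_mk (2 * π) 0).integrable_comp_of_integrable hf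

theorem integrable_of_L2 (f : X) : Integrable (f : S1 → ℝ) :=
  (Lp.memLp f).integrable (by norm_num)

theorem intervalIntegrable_of_L2 (f : X) (a b : ℝ) :
    IntervalIntegrable (fun s : ℝ => f (s : S1)) volume a b :=
  intervalIntegrable_comp_coe (integrable_of_L2 f) a b

/-- Completeness of the trigonometric system in `L²(S¹; ℝ)`. -/
theorem ae_eq_zero_of_integral_cos_sin {h : S1 → ℝ} (hh : MemLp h 2)
    (hc : ∀ n : ℤ, ∫ s in (0 : ℝ)..(2 * π), h s * Real.cos (n * s) = 0)
    (hs : ∀ n : ℤ, ∫ s in (0 : ℝ)..(2 * π), h s * Real.sin (n * s) = 0) :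
    h =ᵐ[volume] 0 := by
  have hC : MemLp (fun θ => (h θ : ℂ)) 2 (@AddCircle.haarAddCircle (2 * π) _) :=
    memLp_haarAddCircle_iff.2 hh.ofReal
  have hint : IntervalIntegrable (fun s : ℝ => h (s : S1)) volume 0 (2 * π) :=
    intervalIntegrable_comp_coe (hh.integrable (by norm_num)) _ _
  have hz : hC.toLp = 0 := by
    apply (fourierBasis (T := 2 * π)).repr.injective
    ext n
    rw [fourierBasis_repr, fourierCoeff_congr_ae hC.coeFn_toLp,
      fourierCoeff_eq_intervalIntegral _ n 0, zero_add]
    have h1 : ∀ s : ℝ, fourier (T := 2 * π) (-n) (s : S1) • (h (s : S1) : ℂ)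
        = ((h s * Real.cos (n * s) : ℝ) : ℂ) - ((h s * Real.sin (n * s) : ℝ) : ℂ) * Complex.I := by
      intro s
      rw [fourier_coe_apply]
      have : 2 * (π : ℂ) * Complex.I * ((-n : ℤ) : ℂ) * s / ((2 * π : ℝ) : ℂ)
          = ((-(n * s) : ℝ) : ℂ) * Complex.I := by
        have : (π : ℂ) ≠ 0 := by exact_mod_cast Real.pi_ne_zero
        push_cast
        field_simp
      rw [this, Complex.exp_mul_I, ← Complex.ofReal_cos, ← Complex.ofReal_sin, Real.cos_neg,
        Real.sin_neg]
      push_cast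
      simp only [smul_eq_mul]
      ring
    have i1 : IntervalIntegrable (fun s : ℝ => h (s : S1) * Real.cos (n * s)) volume 0 (2 * π) :=
      hint.mul_continuousOn (by fun_prop)
    have i2 : IntervalIntegrable (fun s : ℝ => h (s : S1) * Real.sin (n * s)) volume 0 (2 * π) :=
      hint.mul_continuousOn (by fun_prop)
    have h2 : ∫ s in (0 : ℝ)..(2 * π), fourier (T := 2 * π) (-n) (s : S1) • (h (s : S1) : ℂ)
        = 0 := by
      have j1 : IntervalIntegrable (fun s : ℝ => ((h (s : S1) * Real.cos (n * s) : ℝ) : ℂ))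
        volume 0 (2 * π) := ⟨i1.1.ofReal, i1.2.ofReal⟩
      have j2 : IntervalIntegrable (fun s : ℝ => ((h (s : S1) * Real.sin (n * s) : ℝ) : ℂ))
        volume 0 (2 * π) := ⟨i2.1.ofReal, i2.2.ofReal⟩
      rw [intervalIntegral.integral_congr (fun s _ => h1 s),
        intervalIntegral.integral_sub j1 (j2.mul_const _),
        intervalIntegral.integral_mul_const, intervalIntegral.integral_ofReal,
        intervalIntegral.integral_ofReal, hc, hs]
      simp
    rw [h2, smul_zero, map_zero]
    rfl
  have h2 : (fun θ => (h θ : ℂ)) =ᵐ[AddCircle.haarAddCircle] 0 :=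
    hC.coeFn_toLp.symm.trans (by rw [hz]; exact Lp.coeFn_zero _ _ _)
  have h3 : (volume : Measure S1) ≪ AddCircle.haarAddCircle := by
    rw [AddCircle.volume_eq_smul_haarAddCircle]
    exact Measure.smul_absolutelyContinuous
  filter_upwards [h3.ae_eq h2] with θ hθ
  simpa using hθ

/-- Integration by parts for primitives of integrable functions. -/
theorem integral_mul_add_mul_of_primitive {F G f g : ℝ → ℝ} {a b : ℝ}
    (hf : IntervalIntegrable f volume a b) (hg : IntervalIntegrable g volume a b)
    (hF : ∀ t, F t = F a + ∫ s in a..t, f s) (hG : ∀ t, G t = G a + ∫ s in a..t, g s) :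
    ∫ s in a..b, (f s * G s + F s * g s) = F b * G b - F a * G a := by
  have key : ∀ {H h : ℝ → ℝ}, IntervalIntegrable h volume a b →
      (∀ t, H t = H a + ∫ s in a..t, h s) → AbsolutelyContinuousOnInterval H a b ∧
        ∀ᵐ s, s ∈ uIcc a b → deriv H s = h s := by
    intro H h hh hH
    have hc : AbsolutelyContinuousOnInterval (fun _ : ℝ => H a) a b :=
      ((LipschitzWith.const (H a)).lipschitzOnWith (s := uIcc a b)).absolutelyContinuousOnInterval
    have e : H = fun t => H a + ∫ s in a..t, h s := funext hH
    constructor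
    · rw [e]
      exact hc.add (hh.absolutelyContinuousOnInterval_intervalIntegral (by simp))
    · filter_upwards [hh.ae_hasDerivAt_integral] with s hs hsm
      rw [e]
      exact ((hs hsm a (by simp)).const_add (H a)).deriv
  obtain ⟨hF1, hF2⟩ := key hf hF
  obtain ⟨hG1, hG2⟩ := key hg hG
  rw [← hF1.integral_deriv_mul_eq_sub hG1]
  apply intervalIntegral.integral_congr_ae
  filter_upwards [hF2, hG2] with s h1 h2 hs
  rw [h1 (uIoc_subset_uIcc hs), h2 (uIoc_subset_uIcc hs)]

/-- A function with a weak derivative `g` agrees almost everywhere with a periodic primitive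
of `g`. -/
theorem HasWeakDeriv.exists_primitive {f g : X} (h : HasWeakDeriv f g) :
    ∃ F : ℝ → ℝ, Function.Periodic F (2 * π) ∧ (∀ a b : ℝ, F b - F a = ∫ s in a..b, g (s : S1)) ∧
      ∀ᵐ s : ℝ, F s = f (s : S1) := by
  have hg := intervalIntegrable_of_L2 g
  have hf := intervalIntegrable_of_L2 f
  have hg0 : ∫ s in (0 : ℝ)..(2 * π), g (s : S1) = 0 := by
    have := h (fun _ => 1) contDiff_const (fun _ => rfl)
    simpa using this.symm
  set G : ℝ → ℝ := fun t => ∫ s in (0 : ℝ)..t, g (s : S1) with hGdef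
  have hGsub : ∀ a b : ℝ, G b - G a = ∫ s in a..b, g (s : S1) := fun a b =>
    intervalIntegral.integral_interval_sub_left (hg _ _) (hg _ _)
  have hGp : Function.Periodic G (2 * π) := by
    intro t
    have hp : Function.Periodic (fun s : ℝ => g (s : S1)) (2 * π) := fun s => by simp
    have h1 := hp.intervalIntegral_add_eq t 0
    have h2 := hGsub t (t + 2 * π)
    rw [h1, zero_add, hg0] at h2
    linarith
  have hGc : Continuous G := intervalIntegral.continuous_primitive hg 0
  -- `c` is the mean of `f - G`, so that `f - G - c` is orthogonal to constants as well as to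
  -- derivatives of periodic functions.
  set c : ℝ := (2 * π)⁻¹ * ∫ s in (0 : ℝ)..(2 * π), (f (s : S1) - G s) with hc
  have hcG : ∫ s in (0 : ℝ)..(2 * π), (f (s : S1) - G s - c) = 0 := by
    rw [intervalIntegral.integral_sub ((hf _ _).sub (hGc.intervalIntegrable _ _)) (by simp)]
    rw [intervalIntegral.integral_const, hc, smul_eq_mul, sub_zero,
      mul_inv_cancel_left₀ Real.two_pi_pos.ne', sub_self]
  have key : ∀ φ : ℝ → ℝ, ContDiff ℝ (⊤ : ℕ∞) φ → Function.Periodic φ (2 * π) →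
      ∫ s in (0 : ℝ)..(2 * π), (f (s : S1) - G s - c) * deriv φ s = 0 := by
    intro φ hφ hφp
    have hφd : Continuous (deriv φ) := hφ.continuous_deriv (by simp)
    have hφi : ∀ a b, ∫ s in a..b, deriv φ s = φ b - φ a := fun a b =>
      intervalIntegral.integral_deriv_eq_sub
        (fun s _ => (hφ.differentiable (by simp)).differentiableAt) (hφd.intervalIntegrable _ _)
    have e1 := integral_mul_add_mul_of_primitive (F := G) (G := φ) (hg 0 (2 * π))
      (hφd.intervalIntegrable 0 (2 * π)) (fun t => by simp [hGdef])
      (fun t => by rw [hφi]; ring)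
    have e2 := h φ hφ hφp
    have i1 : IntervalIntegrable (fun s : ℝ => g (s : S1) * φ s) volume 0 (2 * π) :=
      (hg _ _).mul_continuousOn hφ.continuous.continuousOn
    have i2 : IntervalIntegrable (fun s : ℝ => f (s : S1) * deriv φ s) volume 0 (2 * π) :=
      (hf _ _).mul_continuousOn hφd.continuousOn
    have i3 : IntervalIntegrable (fun s : ℝ => G s * deriv φ s) volume 0 (2 * π) :=
      (hGc.mul hφd).intervalIntegrable _ _
    have i4 : IntervalIntegrable (fun s : ℝ => c * deriv φ s) volume 0 (2 * π) :=
      (hφd.const_mul c |>.intervalIntegrable _ _)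
    rw [intervalIntegral.integral_add i1 i3] at e1
    have hφ0 : φ (2 * π) = φ 0 := by simpa using hφp 0
    have hG0 : G (2 * π) = 0 := hg0
    have hG0' : G 0 = 0 := by simp [hGdef]
    simp_rw [sub_mul]
    rw [intervalIntegral.integral_sub (i2.sub i3) i4, intervalIntegral.integral_sub i2 i3,
      intervalIntegral.integral_const_mul, hφi, hφ0, e2]
    rw [hG0, hG0'] at e1
    linarith
  have hlift : Continuous (hGp.lift : S1 → ℝ) := continuous_coinduced_dom.2 hGc
  have hmem : MemLp (fun θ : S1 => f θ - hGp.lift θ - c) 2 := by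
    refine ((Lp.memLp f).sub ?_).sub (memLp_const c)
    obtain ⟨C, hC⟩ := isCompact_univ.exists_bound_of_continuousOn hlift.continuousOn
    exact MemLp.of_bound hlift.aestronglyMeasurable C (ae_of_all _ fun θ => hC θ (mem_univ θ))
  -- For `n ≠ 0`, `cos (n s)` and `sin (n s)` are derivatives of smooth periodic functions.
  have hz := ae_eq_zero_of_integral_cos_sin hmem (fun n => ?_) (fun n => ?_)
  · refine ⟨fun t => G t + c, fun t => by simp [hGp t], fun a b => by rw [← hGsub]; ring, ?_⟩
    filter_upwards [ae_coe_of_ae hz] with s hs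
    have : f (s : S1) - G s - c = 0 := hs
    linarith
  · rcases eq_or_ne n 0 with rfl | hn
    · simpa using hcG
    · have hn' : (n : ℝ) ≠ 0 := by exact_mod_cast hn
      have hd : deriv (fun s : ℝ => Real.sin (n * s) / n) = fun s => Real.cos (n * s) := by
        ext s
        have : HasDerivAt (fun s : ℝ => Real.sin (n * s) / n) (Real.cos (n * s) * (n * 1) / n) s :=
          (((hasDerivAt_id s).const_mul (n : ℝ)).sin).div_const (n : ℝ)
        rw [this.deriv]
        field_simp
      have := key (fun s => Real.sin (n * s) / n) (by fun_prop) (fun s => by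
        dsimp only
        rw [mul_add, Real.sin_add_int_mul_two_pi])
      rw [hd] at this
      exact this
  · rcases eq_or_ne n 0 with rfl | hn
    · simp
    · have hn' : (n : ℝ) ≠ 0 := by exact_mod_cast hn
      have hd : deriv (fun s : ℝ => -Real.cos (n * s) / n) = fun s => Real.sin (n * s) := by
        ext s
        have : HasDerivAt (fun s : ℝ => -Real.cos (n * s) / n)
            (-(-Real.sin (n * s) * (n * 1)) / n) s :=
          (((hasDerivAt_id s).const_mul (n : ℝ)).cos).neg.div_const (n : ℝ)
        rw [this.deriv]
        field_simp
      have := key (fun s => -Real.cos (n * s) / n) (by fun_prop) (fun s => by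
        dsimp only
        rw [mul_add, Real.cos_add_int_mul_two_pi])
      rw [hd] at this
      exact this

/-! ### Symmetry of the operator and positivity of eigenfunctions -/

theorem integral_circle (f : S1 → ℝ) : ∫ θ, f θ = ∫ s in (0 : ℝ)..(2 * π), f (s : S1) := by
  rw [← AddCircle.intervalIntegral_preimage (2 * π) 0 f, zero_add]

theorem inner_eq_integral_mul (f g : X) : ⟪f, g⟫_ℝ = ∫ θ, f θ * g θ := by
  rw [L2.inner_def]
  refine integral_congr_ae (ae_of_all _ fun θ => ?_)
  simp [mul_comm]

theorem integrable_mul_of_L2 (f g : X) : Integrable (fun θ : S1 => f θ * g θ) :=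
  (Lp.memLp f).integrable_mul (Lp.memLp g)

theorem ae_abs_coeff_le (a : Coeff) : ∀ᵐ θ : S1, |a θ| ≤ ‖a‖ := by
  have h := ae_le_eLpNormEssSup (f := (a : S1 → ℝ)) (μ := volume)
  filter_upwards [h] with θ hθ
  rw [Lp.norm_def, eLpNorm_exponent_top, ← Real.norm_eq_abs, ← toReal_enorm]
  refine ENNReal.toReal_mono ?_ hθ
  rw [← eLpNorm_exponent_top]
  exact Lp.eLpNorm_ne_top a

/-- The weak derivative is skew-symmetric. -/
theorem HasWeakDeriv.inner_left {f f' e e' : X} (hf : HasWeakDeriv f f')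
    (he : HasWeakDeriv e e') : ⟪f', e⟫_ℝ = - ⟪f, e'⟫_ℝ := by
  obtain ⟨F, hFp, hF, hFf⟩ := hf.exists_primitive
  obtain ⟨E, hEp, hE, hEe⟩ := he.exists_primitive
  have h := integral_mul_add_mul_of_primitive (F := F) (G := E)
    (intervalIntegrable_of_L2 f' 0 (2 * π)) (intervalIntegrable_of_L2 e' 0 (2 * π))
    (fun t => by rw [← hF]; ring) (fun t => by rw [← hE]; ring)
  have hF0 : F (2 * π) = F 0 := by simpa using hFp 0
  have hE0 : E (2 * π) = E 0 := by simpa using hEp 0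
  rw [hF0, hE0, sub_self] at h
  have h2 : ⟪f', e⟫_ℝ + ⟪f, e'⟫_ℝ = 0 := by
    rw [inner_eq_integral_mul, inner_eq_integral_mul,
      ← integral_add (integrable_mul_of_L2 _ _) (integrable_mul_of_L2 _ _), integral_circle]
    refine Eq.trans ?_ h
    apply intervalIntegral.integral_congr_ae
    filter_upwards [hFf, hEe] with s h1 h2 _
    rw [h1, h2]
  linarith

theorem inner_coeff_smul (a : Coeff) (f g : X) :
    ⟪(a • f : X), g⟫_ℝ = ∫ θ, a θ * f θ * g θ := by
  rw [inner_eq_integral_mul]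
  apply integral_congr_ae
  filter_upwards [Lp.coeFn_lpSMul (r := 2) a f] with θ h
  rw [h]
  simp [smul_eq_mul]

theorem inner_coeff_smul_comm (a : Coeff) (f g : X) :
    ⟪(a • f : X), g⟫_ℝ = ⟪f, (a • g : X)⟫_ℝ := by
  rw [real_inner_comm (a • g : X) f, inner_coeff_smul, inner_coeff_smul]
  congr 1
  ext θ
  ring

/-- The operator `𝒜` is symmetric. -/
theorem OpGraph.inner_eq {A : Coeff} {f g e k : X} (hf : OpGraph A f g) (he : OpGraph A e k) :
    ⟪g, e⟫_ℝ = ⟪f, k⟫_ℝ := by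
  obtain ⟨f', f'', h1, h2, rfl⟩ := hf
  obtain ⟨e', e'', h3, h4, rfl⟩ := he
  rw [inner_add_left, inner_add_right, h2.inner_left h3, inner_coeff_smul_comm,
    real_inner_comm e'' f, h4.inner_left h1, real_inner_comm e' f']

/-- A scalar Gronwall lemma in integral form: a nonnegative continuous function bounded by a
multiple of its own primitive vanishes. -/
theorem eq_zero_of_le_mul_integral {H : ℝ → ℝ} (hH : Continuous H) (h0 : ∀ t, 0 ≤ H t)
    {M t₀ : ℝ} (hM : ∀ t, t₀ ≤ t → H t ≤ M * ∫ s in t₀..t, H s) {t : ℝ} (ht : t₀ ≤ t) :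
    H t = 0 := by
  set Φ : ℝ → ℝ := fun t => ∫ s in t₀..t, H s with hΦ
  have hd : ∀ t, HasDerivAt (fun t => Φ t * Real.exp (-M * t))
      (H t * Real.exp (-M * t) + Φ t * (Real.exp (-M * t) * (-M * 1))) t := fun t =>
    (hH.integral_hasStrictDerivAt t₀ t).hasDerivAt.mul
      (((hasDerivAt_id t).const_mul (-M)).exp)
  have hanti : AntitoneOn (fun t => Φ t * Real.exp (-M * t)) (Ici t₀) := by
    refine antitoneOn_of_deriv_nonpos (convex_Ici t₀)
      (fun s _ => (hd s).continuousAt.continuousWithinAt)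
      (fun s _ => (hd s).differentiableAt.differentiableWithinAt) (fun s hs => ?_)
    rw [interior_Ici] at hs
    rw [(hd s).deriv]
    have h1 := hM s (le_of_lt hs)
    have h2 := Real.exp_pos (-M * s)
    have h3 : H s * Real.exp (-M * s) + Φ s * (Real.exp (-M * s) * (-M * 1))
        = (H s - M * Φ s) * Real.exp (-M * s) := by ring
    rw [h3]
    exact mul_nonpos_of_nonpos_of_nonneg (by linarith) h2.le
  have h1 := hanti self_mem_Ici ht ht
  have hΦ0 : Φ t₀ = 0 := by simp [hΦ]
  simp only [hΦ0, zero_mul] at h1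
  have h2 : Φ t ≤ 0 := by
    by_contra hc
    have := mul_pos (not_le.1 hc) (Real.exp_pos (-M * t))
    linarith
  have h3 : 0 ≤ Φ t := intervalIntegral.integral_nonneg ht fun s _ => h0 s
  have h4 : Φ t = 0 := le_antisymm h2 h3
  have h5 := hM t ht
  change H t ≤ M * Φ t at h5
  rw [h4, mul_zero] at h5
  exact le_antisymm h5 (h0 t)

/-- Strict positivity of nonnegative eigenfunctions. -/
theorem OpGraph.exists_bounds {A : Coeff} {e : X} {l : ℝ} (h : OpGraph A e (l • e)) (he : 0 ≤ e)
    (he0 : e ≠ 0) : ∃ c C : ℝ, 0 < c ∧ ∀ᵐ θ : S1, c ≤ e θ ∧ e θ ≤ C := by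
  obtain ⟨e', e'', h1, h2, h3⟩ := h
  obtain ⟨E, hEp, hE, hEe⟩ := h1.exists_primitive
  obtain ⟨D, hDp, hD, hDe⟩ := h2.exists_primitive
  have hDc : Continuous D := by
    have : D = fun t => D 0 + ∫ s in (0 : ℝ)..t, e'' (s : S1) := by
      ext t
      rw [← hD]
      ring
    rw [this]
    exact continuous_const.add
      (intervalIntegral.continuous_primitive (intervalIntegrable_of_L2 e'') 0)
  have hED : ∀ a b : ℝ, E b - E a = ∫ s in a..b, D s := fun a b => by
    rw [hE]
    apply intervalIntegral.integral_congr_ae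
    filter_upwards [hDe] with s hs _
    exact hs.symm
  have hEd : ∀ t, HasDerivAt E (D t) t := fun t => by
    have : E = fun t => E 0 + ∫ s in (0 : ℝ)..t, D s := by
      ext t
      rw [← hED]
      ring
    rw [this]
    exact ((hDc.integral_hasStrictDerivAt 0 t).hasDerivAt).const_add _
  have hEc : Continuous E := continuous_iff_continuousAt.2 fun t => (hEd t).continuousAt
  have hE0 : ∀ t, 0 ≤ E t := by
    have h4 : E =ᵐ[volume] fun t => max (E t) 0 := by
      have he' : ∀ᵐ θ : S1, 0 ≤ e θ := by
        filter_upwards [(Lp.coeFn_nonneg e).2 he] with θ hθ using hθ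
      filter_upwards [hEe, ae_coe_of_ae he'] with s hs hs'
      rw [hs, max_eq_left hs']
    have h5 := (hEc.ae_eq_iff_eq volume (hEc.max continuous_const)).1 h4
    intro t
    rw [h5]
    exact le_max_right _ _
  set M : ℝ := |l| + ‖A‖ with hM
  have hM0 : 0 ≤ M := by positivity
  have hbd : ∀ᵐ s : ℝ, |e'' (s : S1)| ≤ M * |E s| := by
    have h4 : ∀ᵐ θ : S1, |e'' θ| ≤ M * |e θ| := by
      have h5 : e'' = l • e - (A • e : X) := by rw [h3]; abel
      rw [h5]
      filter_upwards [Lp.coeFn_sub (l • e) (A • e : X), Lp.coeFn_smul l e,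
        Lp.coeFn_lpSMul (r := 2) A e, ae_abs_coeff_le A] with θ a1 a2 a3 a4
      rw [a1, Pi.sub_apply, a2, a3]
      simp only [Pi.smul_apply, Pi.smul_apply', smul_eq_mul]
      calc |l * e θ - A θ * e θ| ≤ |l * e θ| + |A θ * e θ| := abs_sub _ _
        _ ≤ M * |e θ| := by
          rw [abs_mul, abs_mul, hM, add_mul]
          gcongr
    filter_upwards [ae_coe_of_ae h4, hEe] with s a1 a2
    rw [a2]
    exact a1
  have hpos : ∀ t, 0 < E t := by
    by_contra hcon
    push Not at hcon
    -- At a zero of `E ≥ 0` also `E' = D` vanishes, so Gronwall applied to `|E| + |D|` propagates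
    -- the zero to the right, and periodicity carries it everywhere.
    obtain ⟨t₀, ht₀⟩ := hcon
    have hE1 : E t₀ = 0 := le_antisymm ht₀ (hE0 t₀)
    have hD1 : D t₀ = 0 := by
      have hmin : IsLocalMin E t₀ := Filter.Eventually.of_forall fun t => by rw [hE1]; exact hE0 t
      exact hmin.hasDerivAt_eq_zero (hEd t₀)
    have hHc : Continuous fun t => |E t| + |D t| := hEc.abs.add hDc.abs
    have hz : ∀ t, t₀ ≤ t → E t = 0 := by
      intro t ht
      have := eq_zero_of_le_mul_integral hHc (fun t => by positivity) (M := M + 1) (t₀ := t₀)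
        (fun t ht => ?_) ht
      · have h5 := abs_nonneg (D t)
        have h6 := abs_nonneg (E t)
        exact abs_eq_zero.1 (by linarith)
      · have i1 : IntervalIntegrable (fun s => |E s|) volume t₀ t := hEc.abs.intervalIntegrable _ _
        have i2 : IntervalIntegrable (fun s => |D s|) volume t₀ t := hDc.abs.intervalIntegrable _ _
        have b1 : |E t| ≤ ∫ s in t₀..t, |D s| := by
          have := hED t₀ t
          rw [hE1, sub_zero] at this
          rw [this]
          exact intervalIntegral.abs_integral_le_integral_abs ht
        have b2 : |D t| ≤ M * ∫ s in t₀..t, |E s| := by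
          have := hD t₀ t
          rw [hD1, sub_zero] at this
          rw [this, ← intervalIntegral.integral_const_mul]
          refine (intervalIntegral.abs_integral_le_integral_abs ht).trans ?_
          exact intervalIntegral.integral_mono_ae ht (intervalIntegrable_of_L2 e'' _ _).abs
            (i1.const_mul M) hbd
        have p1 : 0 ≤ ∫ s in t₀..t, |E s| :=
          intervalIntegral.integral_nonneg ht fun s _ => abs_nonneg _
        have p2 : 0 ≤ ∫ s in t₀..t, |D s| :=
          intervalIntegral.integral_nonneg ht fun s _ => abs_nonneg _
        rw [intervalIntegral.integral_add i1 i2]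
        nlinarith
    have hz' : ∀ t, E t = 0 := by
      intro t
      obtain ⟨n, hn⟩ := exists_nat_ge ((t₀ - t) / (2 * π))
      rw [div_le_iff₀ Real.two_pi_pos] at hn
      rw [← hEp.nat_mul n t]
      exact hz _ (by linarith)
    apply he0
    rw [Lp.eq_zero_iff_ae_eq_zero]
    refine ae_of_ae_coe (P := fun θ => e θ = (0 : S1 → ℝ) θ) ?_ ?_
    · exact measurableSet_eq_fun (Lp.stronglyMeasurable e).measurable measurable_const
    · filter_upwards [hEe] with s hs
      rw [← hs, hz' s]
      rfl
  have hne : (Icc (0 : ℝ) (2 * π)).Nonempty := nonempty_Icc.2 Real.two_pi_pos.le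
  obtain ⟨a, -, ha⟩ := isCompact_Icc.exists_isMinOn hne hEc.continuousOn
  obtain ⟨b, -, hb⟩ := isCompact_Icc.exists_isMaxOn hne hEc.continuousOn
  have hab : ∀ t, E a ≤ E t ∧ E t ≤ E b := by
    intro t
    obtain ⟨s, hs, hst⟩ := hEp.exists_mem_Ico₀ Real.two_pi_pos t
    rw [hst]
    exact ⟨ha (Ico_subset_Icc_self hs), hb (Ico_subset_Icc_self hs)⟩
  refine ⟨E a, E b, hpos a, ae_of_ae_coe ?_ ?_⟩
  · have hm := (Lp.stronglyMeasurable e).measurable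
    exact (measurableSet_le measurable_const hm).inter (measurableSet_le hm measurable_const)
  · filter_upwards [hEe] with s hs
    rw [← hs]
    exact hab s

/-! ### Strongly continuous semigroups and pairing with eigenfunctions -/

namespace IsC0Semigroup

variable {S : ℝ → X →L[ℝ] X}

theorem tendsto_nhdsGE (h : IsC0Semigroup S) (x : X) :
    Tendsto (fun t => S t x) (𝓝[≥] 0) (𝓝 x) := by
  rw [← nhdsGT_sup_nhdsWithin_singleton, tendsto_sup, nhdsWithin_singleton]
  refine ⟨h.tendsto x, ?_⟩
  rw [tendsto_pure_left]
  intro s hs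
  rw [h.zero]
  exact mem_of_mem_nhds hs

/-- By the uniform boundedness principle a `C₀`-semigroup is bounded near `0`. -/
theorem exists_bound_near_zero (h : IsC0Semigroup S) :
    ∃ δ > 0, ∃ M : ℝ, ∀ t, 0 ≤ t → t ≤ δ → ‖S t‖ ≤ M := by
  by_contra! hcon
  have hn : ∀ n : ℕ, ∃ t : ℝ, 0 ≤ t ∧ t ≤ 1 / ((n : ℝ) + 1) ∧ (n : ℝ) < ‖S t‖ := fun n =>
    hcon _ (by positivity) n
  choose t ht0 ht1 ht2 using hn
  have htl : Tendsto t atTop (𝓝[≥] 0) :=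
    tendsto_nhdsWithin_iff.2 ⟨squeeze_zero ht0 ht1 tendsto_one_div_add_atTop_nhds_zero_nat,
      Filter.Eventually.of_forall ht0⟩
  obtain ⟨C, hC⟩ := banach_steinhaus (g := fun n => S (t n)) (fun x => by
    obtain ⟨C, hC⟩ := ((h.tendsto_nhdsGE x).comp htl).norm.bddAbove_range
    exact ⟨C, fun n => hC ⟨n, rfl⟩⟩)
  obtain ⟨n, hn⟩ := exists_nat_gt C
  linarith [hC n, ht2 n]

theorem exists_bound (h : IsC0Semigroup S) (T : ℝ) :
    ∃ M : ℝ, 0 ≤ M ∧ ∀ t, 0 ≤ t → t ≤ T → ‖S t‖ ≤ M := by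
  obtain ⟨δ, hδ, M, hM⟩ := h.exists_bound_near_zero
  have hM0 : 0 ≤ M := (norm_nonneg _).trans (hM 0 le_rfl hδ.le)
  have key : ∀ n : ℕ, ∃ K : ℝ, 0 ≤ K ∧ ∀ t, 0 ≤ t → t ≤ n * δ → ‖S t‖ ≤ K := by
    intro n
    induction n with
    | zero =>
      refine ⟨M, hM0, fun t h0 h1 => hM t h0 ?_⟩
      simp only [Nat.cast_zero, zero_mul] at h1
      linarith
    | succ n ih =>
      obtain ⟨K, hK0, hK⟩ := ih
      refine ⟨max K (K * M), le_max_of_le_left hK0, fun t h0 h1 => ?_⟩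
      rcases le_total t (n * δ) with h2 | h2
      · exact (hK t h0 h2).trans (le_max_left _ _)
      · have h3 : (0 : ℝ) ≤ n * δ := by positivity
        push_cast at h1
        have h4 := h.add (n * δ) (t - n * δ) h3 (by linarith)
        rw [add_sub_cancel] at h4
        rw [h4]
        refine (ContinuousLinearMap.opNorm_comp_le _ _).trans (le_max_of_le_right ?_)
        exact mul_le_mul (hK _ h3 le_rfl) (hM _ (by linarith) (by linarith)) (norm_nonneg _) hK0
  obtain ⟨n, hn⟩ := exists_nat_ge (T / δ)
  obtain ⟨K, hK0, hK⟩ := key n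
  exact ⟨K, hK0, fun t h0 h1 => hK t h0 (h1.trans ((div_le_iff₀ hδ).1 hn))⟩

/-- Increments of an orbit are controlled by its modulus of continuity at time `0`. -/
theorem norm_sub_le (h : IsC0Semigroup S) {M T : ℝ} (hM : ∀ t, 0 ≤ t → t ≤ T → ‖S t‖ ≤ M)
    (x : X) {s t : ℝ} (hs : 0 ≤ s) (ht : 0 ≤ t) (hsT : s ≤ T) (htT : t ≤ T) :
    ‖S t x - S s x‖ ≤ M * ‖S |t - s| x - x‖ := by
  wlog hst : s ≤ t generalizing s t
  · rw [norm_sub_rev, abs_sub_comm]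
    exact this ht hs htT hsT (le_of_not_ge hst)
  have h1 := h.add s (t - s) hs (by linarith)
  rw [add_sub_cancel] at h1
  rw [h1, abs_of_nonneg (by linarith), ContinuousLinearMap.comp_apply, ← map_sub]
  exact (S s).le_of_opNorm_le (hM s hs hsT) _

/-- Joint continuity of a `C₀`-semigroup, with times extended by `max · 0` to the whole line. -/
theorem continuous_uncurry (h : IsC0Semigroup S) :
    Continuous fun p : ℝ × X => S (max p.1 0) p.2 := by
  rw [continuous_iff_continuousAt]
  rintro ⟨t₀, x₀⟩
  obtain ⟨M, hM0, hM⟩ := h.exists_bound (max (t₀ + 1) 0)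
  have hT : ∀ᶠ p : ℝ × X in 𝓝 (t₀, x₀), p.1 < t₀ + 1 :=
    continuous_fst.continuousAt.eventually_lt continuousAt_const (by simp)
  rw [ContinuousAt, tendsto_iff_norm_sub_tendsto_zero]
  have h1 : Tendsto (fun p : ℝ × X => |max p.1 0 - max t₀ 0|) (𝓝 (t₀, x₀)) (𝓝[≥] 0) := by
    refine tendsto_nhdsWithin_iff.2
      ⟨?_, Filter.Eventually.of_forall fun p => mem_Ici.2 (abs_nonneg _)⟩
    have : Continuous fun p : ℝ × X => |max p.1 0 - max t₀ 0| := by fun_prop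
    simpa using this.tendsto (t₀, x₀)
  have h2 : Tendsto (fun p : ℝ × X => M * ‖p.2 - x₀‖ +
      M * ‖S |max p.1 0 - max t₀ 0| x₀ - x₀‖) (𝓝 (t₀, x₀)) (𝓝 0) := by
    have a1 : Tendsto (fun p : ℝ × X => ‖p.2 - x₀‖) (𝓝 (t₀, x₀)) (𝓝 0) := by
      have : Continuous fun p : ℝ × X => ‖p.2 - x₀‖ := by fun_prop
      simpa using this.tendsto (t₀, x₀)
    have a2 := tendsto_iff_norm_sub_tendsto_zero.1 ((h.tendsto_nhdsGE x₀).comp h1)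
    simpa using (a1.const_mul M).add (a2.const_mul M)
  refine squeeze_zero' (Filter.Eventually.of_forall fun p => norm_nonneg _) ?_ h2
  filter_upwards [hT] with p hp
  have b1 : max p.1 0 ≤ max (t₀ + 1) 0 := max_le_max hp.le le_rfl
  have b2 : max t₀ 0 ≤ max (t₀ + 1) 0 := max_le_max (by linarith) le_rfl
  calc ‖S (max p.1 0) p.2 - S (max t₀ 0) x₀‖
      = ‖S (max p.1 0) (p.2 - x₀) + (S (max p.1 0) x₀ - S (max t₀ 0) x₀)‖ := by
        rw [map_sub]; congr 1; abel
    _ ≤ _ := norm_add_le _ _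
    _ ≤ _ := add_le_add ((S _).le_of_opNorm_le (hM _ (le_max_right _ _) b1) _)
        (h.norm_sub_le hM x₀ (le_max_right _ _) (le_max_right _ _) b2 b1)

theorem continuous_orbit (h : IsC0Semigroup S) (x : X) : Continuous fun t => S (max t 0) x :=
  h.continuous_uncurry.comp (by fun_prop : Continuous fun t : ℝ => (t, x))

/-- The convolution integrand of the mild formulation is integrable. -/
theorem intervalIntegrable_conv (h : IsC0Semigroup S) {w : ℝ → X} {t : ℝ} (ht : 0 ≤ t)
    (hw : IntervalIntegrable w volume 0 t) :
    IntervalIntegrable (fun r => S (t - r) (w r)) volume 0 t := by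
  obtain ⟨M, hM0, hM⟩ := h.exists_bound t
  rw [intervalIntegrable_iff, uIoc_of_le ht] at hw ⊢
  have hmeas : AEStronglyMeasurable (fun r => S (max (t - r) 0) (w r))
      (volume.restrict (Ioc 0 t)) :=
    h.continuous_uncurry.comp_aestronglyMeasurable
      ((by fun_prop : Continuous fun r : ℝ => t - r).aestronglyMeasurable.prodMk
        hw.aestronglyMeasurable)
  have heq : ∀ r ∈ Ioc 0 t, S (max (t - r) 0) (w r) = S (t - r) (w r) := fun r hr => by
    rw [max_eq_left (by linarith [hr.2])]
  refine (hw.norm.const_mul M).mono' (hmeas.congr ?_) ?_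
  · exact (ae_restrict_iff' measurableSet_Ioc).2 (ae_of_all _ heq)
  · refine (ae_restrict_iff' measurableSet_Ioc).2 (ae_of_all _ fun r hr => ?_)
    exact (S _).le_of_opNorm_le (hM _ (by linarith [hr.2]) (by linarith [hr.1])) _

/-- Integrals of orbits lie in the domain of the generator, for every initial state. This makes the
pairing with an eigenfunction computable without a density argument for the domain. -/
theorem tendsto_integral_orbit (h : IsC0Semigroup S) (x : X) {t : ℝ} (ht : 0 ≤ t) :
    Tendsto (fun ε : ℝ => ε⁻¹ • (S ε (∫ s in (0 : ℝ)..t, S (max s 0) x)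
      - ∫ s in (0 : ℝ)..t, S (max s 0) x)) (𝓝[>] 0) (𝓝 (S t x - x)) := by
  have hc := h.continuous_orbit x
  have hi : ∀ a b, IntervalIntegrable (fun s => S (max s 0) x) volume a b := fun a b =>
    hc.intervalIntegrable a b
  set G : ℝ → X := fun t => ∫ s in (0 : ℝ)..t, S (max s 0) x with hG
  have hd : ∀ t, 0 ≤ t → HasDerivAt G (S t x) t := fun t ht => by
    have := (hc.integral_hasStrictDerivAt 0 t).hasDerivAt
    rwa [max_eq_left ht] at this
  have h1 := (hasDerivAt_iff_tendsto_slope_zero.1 (hd t ht)).mono_left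
    (nhdsWithin_mono 0 (fun a (ha : 0 < a) => ha.ne') : 𝓝[>] (0 : ℝ) ≤ 𝓝[≠] 0)
  have h2 := (hasDerivAt_iff_tendsto_slope_zero.1 (hd 0 le_rfl)).mono_left
    (nhdsWithin_mono 0 (fun a (ha : 0 < a) => ha.ne') : 𝓝[>] (0 : ℝ) ≤ 𝓝[≠] 0)
  have h3 := h1.sub h2
  rw [h.zero, ContinuousLinearMap.id_apply] at h3
  refine h3.congr' ?_
  filter_upwards [self_mem_nhdsWithin] with ε hε
  have hε' : (0 : ℝ) ≤ ε := le_of_lt hε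
  rw [← smul_sub]
  congr 1
  have e1 : S ε (G t) = G (t + ε) - G ε := by
    rw [hG]
    dsimp only
    rw [← ContinuousLinearMap.intervalIntegral_comp_comm _ (hi 0 t),
      intervalIntegral.integral_interval_sub_left (hi _ _) (hi _ _)]
    have := intervalIntegral.integral_comp_add_right (a := 0) (b := t)
      (fun s => S (max s 0) x) ε
    rw [zero_add] at this
    rw [← this]
    apply intervalIntegral.integral_congr
    intro s hs
    rw [uIcc_of_le ht] at hs
    dsimp only
    rw [max_eq_left hs.1, max_eq_left (add_nonneg hs.1 hε'), add_comm s ε, h.add ε s hε' hs.1]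
    rfl
  have e2 : G 0 = 0 := by simp [hG]
  rw [e1, e2, zero_add, sub_zero]
  abel

end IsC0Semigroup

/-- The scalar linear Volterra equation `m = m₀ + l ∫ m` has only the exponential solution. -/
theorem eq_exp_of_integral_eq {m : ℝ → ℝ} {m₀ l : ℝ} (hm : ContinuousOn m (Ici 0))
    (h : ∀ t, 0 ≤ t → m t = m₀ + l * ∫ s in (0 : ℝ)..t, m s) {t : ℝ} (ht : 0 ≤ t) :
    m t = Real.exp (l * t) * m₀ := by
  set n : ℝ → ℝ := fun t => m (max t 0) with hn
  have hnc : Continuous n :=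
    hm.comp_continuous (by fun_prop) fun t => mem_Ici.2 (le_max_right _ _)
  set I : ℝ → ℝ := fun t => ∫ s in (0 : ℝ)..t, n s with hI
  have hmI : ∀ t, 0 ≤ t → m t = m₀ + l * I t := fun t ht => by
    rw [h t ht]
    congr 2
    apply intervalIntegral.integral_congr
    intro s hs
    rw [uIcc_of_le ht] at hs
    simp [hn, max_eq_left hs.1]
  -- The integrating factor makes `p` constant.
  set p : ℝ → ℝ := fun t => Real.exp (-l * t) * (m₀ + l * I t) with hp
  have hpd : ∀ t, HasDerivAt p (Real.exp (-l * t) * (-l * 1) * (m₀ + l * I t)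
      + Real.exp (-l * t) * (l * n t)) t := fun t =>
    ((((hasDerivAt_id t).const_mul (-l)).exp).mul
      (((hnc.integral_hasStrictDerivAt 0 t).hasDerivAt.const_mul l).const_add m₀))
  have hpc : p t = p 0 := by
    refine constant_of_has_deriv_right_zero (a := 0) (b := t)
      (fun s _ => (hpd s).continuousAt.continuousWithinAt) (fun s hs => ?_) t ⟨ht, le_rfl⟩
    have := (hpd s).hasDerivWithinAt (s := Ici s)
    convert! this using 1
    have h1 : n s = m₀ + l * I s := by
      rw [← hmI s hs.1]
      simp [hn, max_eq_left hs.1]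
    rw [h1]
    ring
  have hI0 : I 0 = 0 := by simp [hI]
  rw [hp] at hpc
  simp only [hI0, ← hmI t ht, mul_zero, add_zero, Real.exp_zero, one_mul] at hpc
  rw [← hpc, ← mul_assoc, ← Real.exp_add]
  simp

/-- Pairing with an eigenfunction turns the semigroup into a scalar exponential. -/
theorem IsGeneratedSemigroup.inner_eigen {A : Coeff} {S : ℝ → X →L[ℝ] X}
    (h : IsGeneratedSemigroup A S) {e : X} {l : ℝ} (he : OpGraph A e (l • e)) (x : X) {t : ℝ}
    (ht : 0 ≤ t) : ⟪S t x, e⟫_ℝ = Real.exp (l * t) * ⟪x, e⟫_ℝ := by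
  have hc := h.1.continuous_orbit x
  have hm : Continuous fun t => ⟪S (max t 0) x, e⟫_ℝ := hc.inner continuous_const
  have key := eq_exp_of_integral_eq (m := fun t => ⟪S (max t 0) x, e⟫_ℝ) (m₀ := ⟪x, e⟫_ℝ) (l := l)
    hm.continuousOn (fun t ht => ?_) ht
  · rwa [max_eq_left ht] at key
  · have h1 := ((h.2 _ _).1 (h.1.tendsto_integral_orbit x ht)).inner_eq he
    have h2 : ⟪∫ s in (0 : ℝ)..t, S (max s 0) x, e⟫_ℝ
        = ∫ s in (0 : ℝ)..t, ⟪S (max s 0) x, e⟫_ℝ := by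
      rw [real_inner_comm]
      have := ContinuousLinearMap.intervalIntegral_comp_comm (innerSL ℝ e)
        (hc.intervalIntegrable (μ := volume) 0 t)
      simp only [innerSL_apply_apply] at this
      rw [← this]
      simp_rw [real_inner_comm]
    rw [inner_sub_left, inner_smul_right, h2] at h1
    rw [max_eq_left ht]
    linarith

/-- Pairing the convolution term of the mild formulation with an eigenfunction. -/
theorem IsGeneratedSemigroup.inner_conv {A : Coeff} {S : ℝ → X →L[ℝ] X}
    (h : IsGeneratedSemigroup A S) {e : X} {l : ℝ} (he : OpGraph A e (l • e)) {w : ℝ → X}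
    {t : ℝ} (ht : 0 ≤ t) (hw : IntervalIntegrable w volume 0 t) :
    ⟪∫ r in (0 : ℝ)..t, S (t - r) (w r), e⟫_ℝ
      = ∫ r in (0 : ℝ)..t, Real.exp (l * (t - r)) * ⟪w r, e⟫_ℝ := by
  rw [real_inner_comm]
  have := ContinuousLinearMap.intervalIntegral_comp_comm (innerSL ℝ e)
    (h.1.intervalIntegrable_conv ht hw)
  simp only [innerSL_apply_apply] at this
  rw [← this]
  apply intervalIntegral.integral_congr
  intro r hr
  rw [uIcc_of_le ht] at hr
  dsimp only
  rw [real_inner_comm, h.inner_eigen he _ (by linarith [hr.2])]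

/-! ### Powers, prices and Young's inequality -/

theorem HasWeakDeriv.smul {f g : X} (h : HasWeakDeriv f g) (c : ℝ) :
    HasWeakDeriv (c • f) (c • g) := by
  intro φ hφ hφp
  have key : ∀ (k : X) (ψ : ℝ → ℝ), ∫ s in (0 : ℝ)..(2 * π), (c • k : X) (s : S1) * ψ s
      = c * ∫ s in (0 : ℝ)..(2 * π), k (s : S1) * ψ s := fun k ψ => by
    rw [← intervalIntegral.integral_const_mul]
    apply intervalIntegral.integral_congr_ae
    filter_upwards [ae_coe_of_ae (Lp.coeFn_smul c k)] with s hs _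
    rw [hs, Pi.smul_apply, smul_eq_mul, mul_assoc]
  rw [key, key, h φ hφ hφp]
  ring

theorem OpGraph.smul {A : Coeff} {f g : X} (h : OpGraph A f g) (c : ℝ) :
    OpGraph A (c • f) (c • g) := by
  obtain ⟨f', f'', h1, h2, rfl⟩ := h
  exact ⟨c • f', c • f'', h1.smul c, h2.smul c, by rw [smul_add, Lp.smul_comm]⟩

/-- Multiplication by a bounded coefficient, as a bounded operator on `X`. -/
def coeffMul (a : Coeff) : X →L[ℝ] X :=
  LinearMap.mkContinuous
    { toFun := fun f => (a • f : X)
      map_add' := fun f g => Lp.add_smul a f g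
      map_smul' := fun c f => (Lp.smul_comm c a f).symm } ‖a‖ fun f => Lp.norm_smul_le a f

theorem ae_nonneg_of_nonneg {p : ℝ≥0∞} {f : Lp ℝ p (volume : Measure S1)} (h : 0 ≤ f) :
    ∀ᵐ θ : S1, 0 ≤ f θ := by
  filter_upwards [(Lp.coeFn_nonneg f).2 h] with θ hθ using hθ

theorem inner_nonneg_of_nonneg {f g : X} (hf : 0 ≤ f) (hg : 0 ≤ g) : 0 ≤ ⟪f, g⟫_ℝ := by
  rw [inner_eq_integral_mul]
  refine integral_nonneg_of_ae ?_
  filter_upwards [ae_nonneg_of_nonneg hf, ae_nonneg_of_nonneg hg] with θ h1 h2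
  exact mul_nonneg h1 h2

theorem inner_pos_of_mem_Xpos0 {f g : X} (hf : f ∈ Xpos0) (hg : ∀ᵐ θ : S1, 0 < g θ) :
    0 < ⟪f, g⟫_ℝ := by
  have h0 : 0 ≤ᵐ[volume] fun θ => f θ * g θ := by
    filter_upwards [ae_nonneg_of_nonneg hf.1, hg] with θ h1 h2
    exact mul_nonneg h1 h2.le
  rw [inner_eq_integral_mul]
  refine (integral_nonneg_of_ae h0).lt_of_ne fun hz => hf.2 ?_
  have h1 := (integral_eq_zero_iff_of_nonneg_ae h0 (integrable_mul_of_L2 f g)).1 hz.symm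
  rw [mem_singleton_iff, Lp.eq_zero_iff_ae_eq_zero]
  filter_upwards [h1, hg] with θ h2 h3
  exact (mul_eq_zero.1 h2).resolve_right h3.ne'

theorem lintegral_eq_inner_coeff_smul {a : Coeff} {f g : X} (ha : 0 ≤ a) (hf : 0 ≤ f)
    (hg : 0 ≤ g) : ∫⁻ θ, ENNReal.ofReal (f θ) * ENNReal.ofReal (g θ) * ENNReal.ofReal (a θ)
      = ENNReal.ofReal ⟪(a • f : X), g⟫_ℝ := by
  have hi : Integrable (fun θ : S1 => a θ * f θ * g θ) := by
    refine (integrable_mul_of_L2 (a • f : X) g).congr ?_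
    filter_upwards [Lp.coeFn_lpSMul (r := 2) a f] with θ h
    rw [h]
    simp [smul_eq_mul]
  rw [inner_coeff_smul, ofReal_integral_eq_lintegral_ofReal hi]
  · apply lintegral_congr_ae
    filter_upwards [ae_nonneg_of_nonneg ha, ae_nonneg_of_nonneg hf] with θ h1 h2
    rw [← ENNReal.ofReal_mul h2, mul_comm _ (ENNReal.ofReal (a θ)), ← ENNReal.ofReal_mul h1,
      mul_assoc]
  · filter_upwards [ae_nonneg_of_nonneg ha, ae_nonneg_of_nonneg hf, ae_nonneg_of_nonneg hg]
      with θ h1 h2 h3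
    positivity

theorem rpow_le_add_of_mem_Icc {c C b : ℝ} (hc : 0 < c) (hb : c ≤ b) (hC : b ≤ C) (q : ℝ) :
    b ^ q ≤ c ^ q + C ^ q := by
  have h1 : 0 ≤ c ^ q := Real.rpow_nonneg hc.le _
  have h2 : 0 ≤ C ^ q := Real.rpow_nonneg (hc.le.trans (hb.trans hC)) _
  rcases le_total 0 q with hq | hq
  · linarith [Real.rpow_le_rpow (hc.le.trans hb) hC hq]
  · linarith [Real.rpow_le_rpow_of_nonpos hc hb hq]

/-- Powers of a function bounded above and away from zero are bounded. -/
theorem memLp_rpow {f : X} {c C : ℝ} (hc : 0 < c) (hf : ∀ᵐ θ : S1, c ≤ f θ ∧ f θ ≤ C) (q : ℝ)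
    (p : ℝ≥0∞) : MemLp (fun θ => f θ ^ q) p := by
  refine MemLp.of_bound ((Lp.stronglyMeasurable f).measurable.pow_const q).aestronglyMeasurable
    (c ^ q + C ^ q) ?_
  filter_upwards [hf] with θ h
  rw [Real.norm_of_nonneg (Real.rpow_nonneg (hc.le.trans h.1) _)]
  exact rpow_le_add_of_mem_Icc hc h.1 h.2 q

theorem integrable_rpow_mul {f : X} {c C : ℝ} (hc : 0 < c) (hf : ∀ᵐ θ : S1, c ≤ f θ ∧ f θ ≤ C)
    (q : ℝ) (a : Coeff) : Integrable (fun θ : S1 => f θ ^ q * a θ) :=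
  memLp_one_iff_integrable.1 ((Lp.memLp a).mul (memLp_rpow hc hf q 1))

theorem integral_rpow_mul_pos {f : X} {c C : ℝ} (hc : 0 < c)
    (hf : ∀ᵐ θ : S1, c ≤ f θ ∧ f θ ≤ C) (q : ℝ) {a : Coeff} (ha : 0 ≤ a) (ha0 : a ≠ 0) :
    0 < ∫ θ, f θ ^ q * a θ := by
  have h0 : 0 ≤ᵐ[volume] fun θ => f θ ^ q * a θ := by
    filter_upwards [ae_nonneg_of_nonneg ha, hf] with θ h1 h2
    exact mul_nonneg (Real.rpow_nonneg (hc.le.trans h2.1) _) h1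
  refine (integral_nonneg_of_ae h0).lt_of_ne fun hz => ha0 ?_
  have h1 := (integral_eq_zero_iff_of_nonneg_ae h0 (integrable_rpow_mul hc hf q a)).1 hz.symm
  rw [Lp.eq_zero_iff_ae_eq_zero]
  filter_upwards [h1, hf] with θ h2 h3
  exact (mul_eq_zero.1 h2).resolve_left (Real.rpow_pos_of_pos (hc.trans_le h3.1) _).ne'

theorem lintegral_rpow_mul {f : X} {c C : ℝ} (hc : 0 < c) (hf : ∀ᵐ θ : S1, c ≤ f θ ∧ f θ ≤ C)
    (q : ℝ) {a : Coeff} (ha : 0 ≤ a) :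
    ∫⁻ θ, ENNReal.ofReal (f θ ^ q) * ENNReal.ofReal (a θ)
      = ENNReal.ofReal (∫ θ, f θ ^ q * a θ) := by
  rw [ofReal_integral_eq_lintegral_ofReal (integrable_rpow_mul hc hf q a)]
  · apply lintegral_congr_ae
    filter_upwards [hf] with θ h
    rw [ENNReal.ofReal_mul (Real.rpow_nonneg (hc.le.trans h.1) _)]
  · filter_upwards [ae_nonneg_of_nonneg ha, hf] with θ h1 h2
    exact mul_nonneg (Real.rpow_nonneg (hc.le.trans h2.1) _) h1

/-- Young's inequality for the utility with `σ < 1`: the Legendre transform of the power function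
at the price `q`. -/
theorem rpow_le_young {σ : ℝ} (hσ : 0 < σ) (hσ1 : σ < 1) {q w : ℝ} (hq : 0 < q) (hw : 0 ≤ w) :
    w ^ (1 - σ) ≤ (1 - σ) * q * w + σ * q ^ (1 - 1 / σ) := by
  have h := Real.geom_mean_le_arith_mean2_weighted (by linarith : 0 ≤ 1 - σ) hσ.le
    (by positivity : 0 ≤ q * w) (Real.rpow_nonneg hq.le (1 - 1 / σ)) (by ring)
  rw [Real.mul_rpow hq.le hw, ← Real.rpow_mul hq.le] at h
  have e : (1 - 1 / σ) * σ = -(1 - σ) := by field_simp; ring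
  rw [e, Real.rpow_neg hq.le, mul_right_comm, mul_inv_cancel₀ (Real.rpow_pos_of_pos hq _).ne',
    one_mul] at h
  linarith

/-- Young's inequality for the utility with `σ > 1`. -/
theorem young_le_rpow {σ : ℝ} (hσ1 : 1 < σ) {q w : ℝ} (hq : 0 < q) (hw : 0 < w) :
    σ * q ^ (1 - 1 / σ) ≤ w ^ (1 - σ) + (σ - 1) * q * w := by
  have hσ : 0 < σ := by linarith
  have h := Real.geom_mean_le_arith_mean2_weighted (by positivity : 0 ≤ 1 / σ)
    (sub_nonneg.2 ((div_le_one hσ).2 hσ1.le)) (Real.rpow_nonneg hw.le (1 - σ))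
    (by positivity : 0 ≤ q * w) (by ring)
  rw [Real.mul_rpow hq.le hw.le, ← Real.rpow_mul hw.le] at h
  have e : (1 - σ) * (1 / σ) = -(1 - 1 / σ) := by field_simp; ring
  rw [e, Real.rpow_neg hw.le, mul_left_comm, inv_mul_cancel₀ (Real.rpow_pos_of_pos hw _).ne',
    mul_one] at h
  have h2 := mul_le_mul_of_nonneg_left h hσ.le
  have e2 : σ * (1 / σ * w ^ (1 - σ) + (1 - 1 / σ) * (q * w))
      = w ^ (1 - σ) + (σ - 1) * q * w := by field_simp
  rwa [e2] at h2

theorem ofReal_rpow_le_young {σ : ℝ} (hσ : 0 < σ) (hσ1 : σ < 1) {q w : ℝ} (hq : 0 < q)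
    (hw : 0 ≤ w) : ENNReal.ofReal w ^ (1 - σ)
      ≤ ENNReal.ofReal (1 - σ) * ENNReal.ofReal q * ENNReal.ofReal w
        + ENNReal.ofReal σ * ENNReal.ofReal (q ^ (1 - 1 / σ)) := by
  have h1 : 0 ≤ 1 - σ := by linarith
  have h2 := Real.rpow_nonneg hq.le (1 - 1 / σ)
  rw [ENNReal.ofReal_rpow_of_nonneg hw h1, ← ENNReal.ofReal_mul h1,
    ← ENNReal.ofReal_mul (by positivity), ← ENNReal.ofReal_mul hσ.le,
    ← ENNReal.ofReal_add (by positivity) (by positivity)]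
  exact ENNReal.ofReal_le_ofReal (rpow_le_young hσ hσ1 hq hw)

theorem young_le_ofReal_rpow {σ : ℝ} (hσ1 : 1 < σ) {q w : ℝ} (hq : 0 < q) (hw : 0 ≤ w) :
    ENNReal.ofReal σ * ENNReal.ofReal (q ^ (1 - 1 / σ))
      ≤ ENNReal.ofReal w ^ (1 - σ)
        + ENNReal.ofReal (σ - 1) * ENNReal.ofReal q * ENNReal.ofReal w := by
  rcases hw.eq_or_lt with rfl | hw
  -- In `ℝ≥0∞` a negative power of `0` is `∞`, so the inequality is trivial there.
  · rw [ENNReal.ofReal_zero, ENNReal.zero_rpow_of_neg (by linarith)]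
    simp
  · have h1 : 0 ≤ σ - 1 := by linarith
    have h2 := Real.rpow_nonneg hw.le (1 - σ)
    have h3 : 0 ≤ (σ - 1) * q := mul_nonneg h1 hq.le
    rw [ENNReal.ofReal_rpow_of_pos hw, ← ENNReal.ofReal_mul h1,
      ← ENNReal.ofReal_mul h3, ← ENNReal.ofReal_mul (by linarith),
      ← ENNReal.ofReal_add h2 (mul_nonneg h3 hw.le)]
    exact ENNReal.ofReal_le_ofReal (young_le_rpow hσ1 hq hw)

/-- The two terms of Young's inequality at the price `p β`, integrated against `N`. -/
theorem lintegral_price_terms {β u : X} {N : Coeff} (hN : 0 ≤ N) {c C : ℝ} (hc : 0 < c)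
    (hβ : ∀ᵐ θ : S1, c ≤ β θ ∧ β θ ≤ C) (hβ0 : 0 ≤ β) (hu : 0 ≤ u) {p : ℝ} (hp : 0 < p)
    (q : ℝ) (r s : ℝ≥0∞) :
    ∫⁻ θ, r * ENNReal.ofReal (p * β θ) * ENNReal.ofReal (u θ) * ENNReal.ofReal (N θ)
      = r * ENNReal.ofReal p * ENNReal.ofReal ⟪(N • u : X), β⟫_ℝ ∧
    ∫⁻ θ, s * ENNReal.ofReal ((p * β θ) ^ q) * ENNReal.ofReal (N θ)
      = s * ENNReal.ofReal (p ^ q) * ENNReal.ofReal (∫ θ, β θ ^ q * N θ) := by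
  have mβ := (Lp.stronglyMeasurable β).measurable
  have mu := (Lp.stronglyMeasurable u).measurable
  have mN := (Lp.stronglyMeasurable N).measurable
  constructor
  · rw [← lintegral_eq_inner_coeff_smul hN hu hβ0, ← lintegral_const_mul _ (by fun_prop)]
    refine lintegral_congr fun θ => ?_
    rw [ENNReal.ofReal_mul hp.le]
    ring
  · rw [← lintegral_rpow_mul hc hβ q hN, ← lintegral_const_mul _ (by fun_prop)]
    apply lintegral_congr_ae
    filter_upwards [hβ] with θ h
    rw [Real.mul_rpow hp.le (hc.le.trans h.1), ENNReal.ofReal_mul (Real.rpow_nonneg hp.le _)]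
    ring

/-- Upper bound for the instantaneous utility at shadow price `p β`, case `σ < 1`. -/
theorem powerIntegral_le {σ : ℝ} (hσ : 0 < σ) (hσ1 : σ < 1) {β u : X} {N : Coeff} (hN : 0 ≤ N)
    {c C : ℝ} (hc : 0 < c) (hβ : ∀ᵐ θ : S1, c ≤ β θ ∧ β θ ≤ C) (hβ0 : 0 ≤ β) (hu : 0 ≤ u)
    {p : ℝ} (hp : 0 < p) :
    powerIntegral σ N u
      ≤ ENNReal.ofReal (1 - σ) * ENNReal.ofReal p * ENNReal.ofReal ⟪(N • u : X), β⟫_ℝ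
        + ENNReal.ofReal σ * ENNReal.ofReal (p ^ (1 - 1 / σ))
          * ENNReal.ofReal (∫ θ, β θ ^ (1 - 1 / σ) * N θ) := by
  have mβ := (Lp.stronglyMeasurable β).measurable
  have mN := (Lp.stronglyMeasurable N).measurable
  obtain ⟨e1, e2⟩ := lintegral_price_terms hN hc hβ hβ0 hu hp (1 - 1 / σ) (ENNReal.ofReal (1 - σ))
    (ENNReal.ofReal σ)
  rw [← e1, ← e2, ← lintegral_add_right _ (by fun_prop)]
  apply lintegral_mono_ae
  filter_upwards [hβ, ae_nonneg_of_nonneg hu] with θ h1 h2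
  rw [← add_mul]
  gcongr
  exact ofReal_rpow_le_young hσ hσ1 (mul_pos hp (hc.trans_le h1.1)) h2

/-- Lower bound for the power integral at shadow price `p β`, case `σ > 1`. -/
theorem le_powerIntegral {σ : ℝ} (hσ1 : 1 < σ) {β u : X} {N : Coeff} (hN : 0 ≤ N)
    {c C : ℝ} (hc : 0 < c) (hβ : ∀ᵐ θ : S1, c ≤ β θ ∧ β θ ≤ C) (hβ0 : 0 ≤ β) (hu : 0 ≤ u)
    {p : ℝ} (hp : 0 < p) :
    ENNReal.ofReal σ * ENNReal.ofReal (p ^ (1 - 1 / σ))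
          * ENNReal.ofReal (∫ θ, β θ ^ (1 - 1 / σ) * N θ)
      ≤ powerIntegral σ N u
        + ENNReal.ofReal (σ - 1) * ENNReal.ofReal p * ENNReal.ofReal ⟪(N • u : X), β⟫_ℝ := by
  have mβ := (Lp.stronglyMeasurable β).measurable
  have mu := (Lp.stronglyMeasurable u).measurable
  have mN := (Lp.stronglyMeasurable N).measurable
  obtain ⟨e1, e2⟩ := lintegral_price_terms hN hc hβ hβ0 hu hp (1 - 1 / σ) (ENNReal.ofReal (σ - 1))
    (ENNReal.ofReal σ)
  rw [← e1, ← e2, powerIntegral, ← lintegral_add_right _ (by fun_prop)]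
  apply lintegral_mono_ae
  filter_upwards [hβ, ae_nonneg_of_nonneg hu] with θ h1 h2
  rw [← add_mul]
  gcongr
  exact young_le_ofReal_rpow hσ1 (mul_pos hp (hc.trans_le h1.1)) h2

theorem coeFn_powL2 {f : X} {q : ℝ} (h : MemLp (fun θ => f θ ^ q) 2 (volume : Measure S1)) :
    ∀ᵐ θ : S1, powL2 f q θ = f θ ^ q := by
  rw [powL2, dif_pos h]
  exact h.coeFn_toLp

/-- The power integral of a multiple of `β^{-1/σ}`. -/
theorem powerIntegral_smul_powL2 {σ : ℝ} (hσ : 0 < σ) {β : X} {N : Coeff} (hN : 0 ≤ N) {c C : ℝ}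
    (hc : 0 < c) (hβ : ∀ᵐ θ : S1, c ≤ β θ ∧ β θ ≤ C) {m : ℝ} (hm : 0 < m) :
    powerIntegral σ N (m • powL2 β (-1 / σ)) = ENNReal.ofReal (m ^ (1 - σ))
      * ENNReal.ofReal (∫ θ, β θ ^ (1 - 1 / σ) * N θ) := by
  have mβ := (Lp.stronglyMeasurable β).measurable
  have mN := (Lp.stronglyMeasurable N).measurable
  rw [← lintegral_rpow_mul hc hβ _ hN, ← lintegral_const_mul _ (by fun_prop), powerIntegral]
  apply lintegral_congr_ae
  filter_upwards [hβ, Lp.coeFn_smul m (powL2 β (-1 / σ)), coeFn_powL2 (memLp_rpow hc hβ (-1 / σ) 2)]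
    with θ h1 h2 h3
  have hb : 0 < β θ := hc.trans_le h1.1
  have hb' := Real.rpow_pos_of_pos hb (-1 / σ)
  have e : -1 / σ * (1 - σ) = 1 - 1 / σ := by field_simp; ring
  rw [h2, Pi.smul_apply, h3, smul_eq_mul, ENNReal.ofReal_rpow_of_pos (by positivity),
    Real.mul_rpow hm.le hb'.le, ← Real.rpow_mul hb.le, e,
    ENNReal.ofReal_mul (Real.rpow_nonneg hm.le _), mul_assoc]

theorem inner_coeff_smul_powL2 {σ : ℝ} {β : X} (N : Coeff) {c C : ℝ}
    (hc : 0 < c) (hβ : ∀ᵐ θ : S1, c ≤ β θ ∧ β θ ≤ C) :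
    ⟪(N • powL2 β (-1 / σ) : X), β⟫_ℝ = ∫ θ, β θ ^ (1 - 1 / σ) * N θ := by
  rw [inner_coeff_smul]
  apply integral_congr_ae
  filter_upwards [hβ, coeFn_powL2 (memLp_rpow hc hβ (-1 / σ) 2)] with θ h1 h2
  have hb : 0 < β θ := hc.trans_le h1.1
  have e : 1 - 1 / σ = -1 / σ + 1 := by ring
  rw [h2, e, Real.rpow_add hb, Real.rpow_one]
  ring

/-! ### The budget constraint and the bound on the discounted utility -/

/-- Variation of constants for the scalar quantity `⟪y^{x,u}(t), β⟫`. -/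
theorem inner_traj {A N : Coeff} (hS : IsGeneratedSemigroup A (expA A)) {β : X} {l : ℝ}
    (hβ : OpGraph A β (l • β)) (x : X) {u : ℝ → X} {t : ℝ} (ht : 0 ≤ t)
    (hu : IntervalIntegrable u volume 0 t) :
    ⟪traj A N x u t, β⟫_ℝ = Real.exp (l * t)
      * (⟪x, β⟫_ℝ - ∫ r in (0 : ℝ)..t, Real.exp (-l * r) * ⟪(N • u r : X), β⟫_ℝ) := by
  have hNu : IntervalIntegrable (fun r => (N • u r : X)) volume 0 t :=
    ⟨(coeffMul N).integrable_comp hu.1, (coeffMul N).integrable_comp hu.2⟩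
  rw [traj, inner_sub_left, hS.inner_eigen hβ x ht, hS.inner_conv hβ ht hNu, mul_sub,
    ← intervalIntegral.integral_const_mul]
  congr 1
  apply intervalIntegral.integral_congr
  intro r _
  dsimp only
  rw [← mul_assoc, ← Real.exp_add]
  congr 2
  ring

theorem intervalIntegrable_of_locallyIntegrableOn {u : ℝ → X}
    (hu : LocallyIntegrableOn u (Ici 0) volume) {t : ℝ} (ht : 0 ≤ t) :
    IntervalIntegrable u volume 0 t := by
  rw [intervalIntegrable_iff, uIoc_of_le ht]
  exact (hu.integrableOn_compact_subset Icc_subset_Ici_self isCompact_Icc).mono_set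
    Ioc_subset_Icc_self

theorem intervalIntegrable_price {N : Coeff} {u : ℝ → X}
    (hu : LocallyIntegrableOn u (Ici 0) volume) (β : X) (l : ℝ) {t : ℝ} (ht : 0 ≤ t) :
    IntervalIntegrable (fun r => Real.exp (-l * r) * ⟪(N • u r : X), β⟫_ℝ) volume 0 t := by
  have h := intervalIntegrable_of_locallyIntegrableOn hu ht
  have h2 : IntervalIntegrable (fun r => ⟪β, (N • u r : X)⟫_ℝ) volume 0 t :=
    ⟨((innerSL ℝ β).comp (coeffMul N)).integrable_comp h.1,
      ((innerSL ℝ β).comp (coeffMul N)).integrable_comp h.2⟩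
  refine IntervalIntegrable.continuousOn_mul ?_ (by fun_prop)
  simpa only [real_inner_comm] using h2

theorem Ioi_eq_iUnion_Ioc_nat : Ioi (0 : ℝ) = ⋃ n : ℕ, Ioc (0 : ℝ) n := by
  ext t
  simp only [mem_Ioi, mem_iUnion, mem_Ioc]
  exact ⟨fun h => (exists_nat_ge t).imp fun n hn => ⟨h, hn⟩, fun ⟨_, h, _⟩ => h⟩

theorem aemeasurable_price {N : Coeff} {u : ℝ → X}
    (hu : LocallyIntegrableOn u (Ici 0) volume) (β : X) (l : ℝ) :
    AEMeasurable (fun r => ENNReal.ofReal (Real.exp (-l * r) * ⟪(N • u r : X), β⟫_ℝ))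
      (volume.restrict (Ioi (0 : ℝ))) := by
  rw [Ioi_eq_iUnion_Ioc_nat, aemeasurable_iUnion_iff]
  intro n
  have h := (intervalIntegrable_price (N := N) hu β l n.cast_nonneg).1
  exact h.aestronglyMeasurable.aemeasurable.ennreal_ofReal

/-- The intertemporal budget constraint: the discounted cost of an admissible control at the
prices `β` is at most the value `⟨x, β⟩` of the initial state, since the state never becomes
negative. -/
theorem lintegral_price_le {A N : Coeff} (hN : 0 ≤ N) (hS : IsGeneratedSemigroup A (expA A))
    {β : X} {l : ℝ} (hβ : OpGraph A β (l • β)) (hβ0 : 0 ≤ β) {x : X} {u : ℝ → X}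
    (hu : u ∈ Admissible A N x) :
    ∫⁻ r in Ioi (0 : ℝ), ENNReal.ofReal (Real.exp (-l * r) * ⟪(N • u r : X), β⟫_ℝ)
      ≤ ENNReal.ofReal ⟪x, β⟫_ℝ := by
  obtain ⟨h1, h2, h3⟩ := hu
  have hmono : Monotone fun n : ℕ => Ioc (0 : ℝ) n := fun m n hmn =>
    Ioc_subset_Ioc_right (by exact_mod_cast hmn)
  rw [Ioi_eq_iUnion_Ioc_nat, setLIntegral_iUnion_of_directed _ hmono.directed_le]
  refine iSup_le fun n => ?_
  have hn : (0 : ℝ) ≤ n := n.cast_nonneg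
  have hi := intervalIntegrable_price (N := N) h1 β l hn
  rw [← ofReal_integral_eq_lintegral_ofReal hi.1]
  · apply ENNReal.ofReal_le_ofReal
    rw [← intervalIntegral.integral_of_le hn]
    have h4 := inner_nonneg_of_nonneg (h3 n hn).1 hβ0
    rw [inner_traj hS hβ x hn (intervalIntegrable_of_locallyIntegrableOn h1 hn)] at h4
    have h5 := nonneg_of_mul_nonneg_right h4 (Real.exp_pos _)
    linarith
  · have h4 : Ioc (0 : ℝ) n ⊆ Ici 0 := fun r hr => hr.1.le
    filter_upwards [ae_restrict_of_ae_restrict_of_subset h4 h2] with r hr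
    refine mul_nonneg (Real.exp_pos _).le ?_
    refine inner_nonneg_of_nonneg ((Lp.coeFn_nonneg _).1 ?_) hβ0
    filter_upwards [Lp.coeFn_lpSMul (r := 2) N (u r), ae_nonneg_of_nonneg hN,
      ae_nonneg_of_nonneg hr] with θ a1 a2 a3
    rw [a1]
    exact mul_nonneg a2 a3

theorem lintegral_exp_decay {K : ℝ} (hK : 0 < K) :
    ∫⁻ t in Ioi (0 : ℝ), ENNReal.ofReal (K * Real.exp (-K * t)) = 1 := by
  rw [← ofReal_integral_eq_lintegral_ofReal
    ((integrableOn_exp_mul_Ioi (by linarith) 0).const_mul K)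
    (ae_of_all _ fun t => by positivity), integral_const_mul, integral_exp_mul_Ioi (by linarith)]
  simp [hK.ne']

/-- Discounting at rate `ρ` of the price level `p = m^{-σ} e^{(ρ-l)t}` and of the power
`p^{1-1/σ}` that enters its Legendre transform. The growth rate `ρ - l` is chosen to reproduce the
weight `e^{-lt}` of the budget constraint. -/
theorem exp_mul_price {ρ σ l K m : ℝ} (hσ : 0 < σ) (hK : K * σ = ρ - l * (1 - σ)) (hm : 0 < m)
    (t : ℝ) :
    Real.exp (-ρ * t) * (m ^ (-σ) * Real.exp ((ρ - l) * t)) = m ^ (-σ) * Real.exp (-l * t) ∧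
    Real.exp (-ρ * t) * (m ^ (-σ) * Real.exp ((ρ - l) * t)) ^ (1 - 1 / σ)
      = m ^ (1 - σ) * Real.exp (-K * t) := by
  constructor
  · rw [mul_left_comm, ← Real.exp_add]
    congr 2
    ring
  · rw [Real.mul_rpow (Real.rpow_nonneg hm.le _) (Real.exp_pos _).le, ← Real.rpow_mul hm.le,
      ← Real.exp_mul, mul_left_comm, ← Real.exp_add]
    have e1 : -σ * (1 - 1 / σ) = 1 - σ := by field_simp; ring
    have e2 : -ρ * t + (ρ - l) * t * (1 - 1 / σ) = -K * t := by
      have : K = (ρ - l * (1 - σ)) / σ := by rw [← hK]; field_simp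
      rw [this]
      field_simp
      ring
    rw [e1, e2]

theorem ofReal_exp_mul_price {ρ σ l K m : ℝ} (hσ : 0 < σ) (hK : K * σ = ρ - l * (1 - σ))
    (hK0 : 0 < K) (hm : 0 < m) (t a : ℝ) (r s : ℝ≥0∞) :
    ENNReal.ofReal (Real.exp (-ρ * t)) * (r * ENNReal.ofReal (m ^ (-σ) * Real.exp ((ρ - l) * t))
      * ENNReal.ofReal a)
      = r * ENNReal.ofReal (m ^ (-σ)) * ENNReal.ofReal (Real.exp (-l * t) * a) ∧
    ENNReal.ofReal (Real.exp (-ρ * t)) * (s * ENNReal.ofReal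
      ((m ^ (-σ) * Real.exp ((ρ - l) * t)) ^ (1 - 1 / σ)) * ENNReal.ofReal K)
      = s * ENNReal.ofReal (m ^ (1 - σ)) * ENNReal.ofReal (K * Real.exp (-K * t)) := by
  obtain ⟨h1, h2⟩ := exp_mul_price hσ hK hm t
  have hE := (Real.exp_pos (-ρ * t)).le
  constructor
  · calc _ = r * (ENNReal.ofReal (Real.exp (-ρ * t))
          * ENNReal.ofReal (m ^ (-σ) * Real.exp ((ρ - l) * t))) * ENNReal.ofReal a := by ring
      _ = _ := by
        rw [← ENNReal.ofReal_mul hE, h1, ENNReal.ofReal_mul (Real.rpow_nonneg hm.le _),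
          ENNReal.ofReal_mul (Real.exp_pos _).le]
        ring
  · calc _ = s * (ENNReal.ofReal (Real.exp (-ρ * t))
          * ENNReal.ofReal ((m ^ (-σ) * Real.exp ((ρ - l) * t)) ^ (1 - 1 / σ)))
            * ENNReal.ofReal K := by ring
      _ = _ := by
        rw [← ENNReal.ofReal_mul hE, h2, ENNReal.ofReal_mul (Real.rpow_nonneg hm.le _),
          ENNReal.ofReal_mul hK0.le]
        ring

theorem rpow_neg_mul_self {m : ℝ} (hm : 0 < m) (σ : ℝ) : m ^ (-σ) * m = m ^ (1 - σ) := by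
  rw [sub_eq_neg_add, Real.rpow_add hm, Real.rpow_one]

/-- The bound `J ≤ v` for `σ < 1`, multiplied by `1 - σ`: Young's inequality at the price
`m^{-σ} e^{(ρ-l)t} β` followed by the budget constraint. -/
theorem lintegral_utility_le {ρ σ : ℝ} (hσ : 0 < σ) (hσ1 : σ < 1) {A N : Coeff} (hN : 0 ≤ N)
    (hS : IsGeneratedSemigroup A (expA A)) {β : X} {l K : ℝ} (hβ : OpGraph A β (l • β))
    (hβ0 : 0 ≤ β) {c C : ℝ} (hc : 0 < c) (hβb : ∀ᵐ θ : S1, c ≤ β θ ∧ β θ ≤ C)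
    (hKβ : ∫ θ, β θ ^ (1 - 1 / σ) * N θ = K) (hK : K * σ = ρ - l * (1 - σ)) (hK0 : 0 < K)
    {x : X} (hx : 0 < ⟪x, β⟫_ℝ) {u : ℝ → X} (hu : u ∈ Admissible A N x) :
    ∫⁻ t in Ioi (0 : ℝ), ENNReal.ofReal (Real.exp (-ρ * t)) * powerIntegral σ N (u t)
      ≤ ENNReal.ofReal (⟪x, β⟫_ℝ ^ (1 - σ)) := by
  set m : ℝ := ⟪x, β⟫_ℝ with hm
  have hpos : ∀ᵐ t ∂(volume.restrict (Ioi (0 : ℝ))), u t ∈ Xpos :=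
    ae_restrict_of_ae_restrict_of_subset Ioi_subset_Ici_self hu.2.1
  have hme := aemeasurable_price (N := N) hu.1 β l
  calc _ ≤ ∫⁻ t in Ioi (0 : ℝ),
        (ENNReal.ofReal (1 - σ) * ENNReal.ofReal (m ^ (-σ))
          * ENNReal.ofReal (Real.exp (-l * t) * ⟪(N • u t : X), β⟫_ℝ)
        + ENNReal.ofReal σ * ENNReal.ofReal (m ^ (1 - σ))
          * ENNReal.ofReal (K * Real.exp (-K * t))) := by
        apply lintegral_mono_ae
        filter_upwards [hpos] with t ht
        have h1 := powerIntegral_le hσ hσ1 hN hc hβb hβ0 ht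
          (p := m ^ (-σ) * Real.exp ((ρ - l) * t))
          (mul_pos (Real.rpow_pos_of_pos hx _) (Real.exp_pos _))
        obtain ⟨e1, e2⟩ := ofReal_exp_mul_price hσ hK hK0 hx t ⟪(N • u t : X), β⟫_ℝ
          (ENNReal.ofReal (1 - σ)) (ENNReal.ofReal σ)
        rw [← e1, ← e2, ← mul_add]
        rw [hKβ] at h1
        gcongr
    _ = ENNReal.ofReal (1 - σ) * ENNReal.ofReal (m ^ (-σ))
          * (∫⁻ t in Ioi (0 : ℝ), ENNReal.ofReal (Real.exp (-l * t) * ⟪(N • u t : X), β⟫_ℝ))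
        + ENNReal.ofReal σ * ENNReal.ofReal (m ^ (1 - σ)) := by
        rw [lintegral_add_right _ (by fun_prop), lintegral_const_mul' _ _ (by finiteness),
          lintegral_const_mul' _ _ (by finiteness), lintegral_exp_decay hK0, mul_one]
    _ ≤ ENNReal.ofReal (1 - σ) * ENNReal.ofReal (m ^ (-σ)) * ENNReal.ofReal m
        + ENNReal.ofReal σ * ENNReal.ofReal (m ^ (1 - σ)) := by
        gcongr
        exact lintegral_price_le hN hS hβ hβ0 hu
    _ = ENNReal.ofReal (m ^ (1 - σ)) := by
        have h1 := Real.rpow_nonneg hx.le (-σ)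
        have h2 : 0 ≤ 1 - σ := by linarith
        rw [mul_assoc, ← ENNReal.ofReal_mul h1, rpow_neg_mul_self hx, ← add_mul,
          ← ENNReal.ofReal_add h2 hσ.le, sub_add_cancel, ENNReal.ofReal_one, one_mul]

/-- The bound `J ≤ v` for `σ > 1`, multiplied by `1 - σ < 0`. Here the power integral may be
infinite, which corresponds to `J = -∞`. -/
theorem le_lintegral_utility {ρ σ : ℝ} (hσ1 : 1 < σ) {A N : Coeff} (hN : 0 ≤ N)
    (hS : IsGeneratedSemigroup A (expA A)) {β : X} {l K : ℝ} (hβ : OpGraph A β (l • β))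
    (hβ0 : 0 ≤ β) {c C : ℝ} (hc : 0 < c) (hβb : ∀ᵐ θ : S1, c ≤ β θ ∧ β θ ≤ C)
    (hKβ : ∫ θ, β θ ^ (1 - 1 / σ) * N θ = K) (hK : K * σ = ρ - l * (1 - σ)) (hK0 : 0 < K)
    {x : X} (hx : 0 < ⟪x, β⟫_ℝ) {u : ℝ → X} (hu : u ∈ Admissible A N x) :
    ENNReal.ofReal (⟪x, β⟫_ℝ ^ (1 - σ))
      ≤ ∫⁻ t in Ioi (0 : ℝ), ENNReal.ofReal (Real.exp (-ρ * t)) * powerIntegral σ N (u t) := by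
  have hσ : 0 < σ := by linarith
  set m : ℝ := ⟪x, β⟫_ℝ with hm
  have hpos : ∀ᵐ t ∂(volume.restrict (Ioi (0 : ℝ))), u t ∈ Xpos :=
    ae_restrict_of_ae_restrict_of_subset Ioi_subset_Ici_self hu.2.1
  have hme := aemeasurable_price (N := N) hu.1 β l
  have key : ENNReal.ofReal σ * ENNReal.ofReal (m ^ (1 - σ))
      ≤ (∫⁻ t in Ioi (0 : ℝ), ENNReal.ofReal (Real.exp (-ρ * t)) * powerIntegral σ N (u t))
        + ENNReal.ofReal (σ - 1) * ENNReal.ofReal (m ^ (1 - σ)) := by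
    calc _ = ∫⁻ t in Ioi (0 : ℝ), ENNReal.ofReal σ * ENNReal.ofReal (m ^ (1 - σ))
            * ENNReal.ofReal (K * Real.exp (-K * t)) := by
          rw [lintegral_const_mul' _ _ (by finiteness), lintegral_exp_decay hK0, mul_one]
      _ ≤ ∫⁻ t in Ioi (0 : ℝ), (ENNReal.ofReal (Real.exp (-ρ * t)) * powerIntegral σ N (u t)
            + ENNReal.ofReal (σ - 1) * ENNReal.ofReal (m ^ (-σ))
              * ENNReal.ofReal (Real.exp (-l * t) * ⟪(N • u t : X), β⟫_ℝ)) := by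
          apply lintegral_mono_ae
          filter_upwards [hpos] with t ht
          have h1 := le_powerIntegral hσ1 hN hc hβb hβ0 ht
            (p := m ^ (-σ) * Real.exp ((ρ - l) * t))
            (mul_pos (Real.rpow_pos_of_pos hx _) (Real.exp_pos _))
          obtain ⟨e1, e2⟩ := ofReal_exp_mul_price hσ hK hK0 hx t ⟪(N • u t : X), β⟫_ℝ
            (ENNReal.ofReal (σ - 1)) (ENNReal.ofReal σ)
          rw [← e1, ← e2, ← mul_add]
          rw [hKβ] at h1
          gcongr
      _ = (∫⁻ t in Ioi (0 : ℝ), ENNReal.ofReal (Real.exp (-ρ * t)) * powerIntegral σ N (u t))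
          + ENNReal.ofReal (σ - 1) * ENNReal.ofReal (m ^ (-σ))
          * (∫⁻ t in Ioi (0 : ℝ), ENNReal.ofReal (Real.exp (-l * t) * ⟪(N • u t : X), β⟫_ℝ)) := by
          rw [lintegral_add_right' _ (hme.const_mul _), lintegral_const_mul' _ _ (by finiteness)]
      _ ≤ (∫⁻ t in Ioi (0 : ℝ), ENNReal.ofReal (Real.exp (-ρ * t)) * powerIntegral σ N (u t))
          + ENNReal.ofReal (σ - 1) * ENNReal.ofReal (m ^ (-σ)) * ENNReal.ofReal m := by
          gcongr
          exact lintegral_price_le hN hS hβ hβ0 hu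
      _ = _ := by
          rw [mul_assoc, ← ENNReal.ofReal_mul (Real.rpow_nonneg hx.le (-σ)), rpow_neg_mul_self hx]
  have e : ENNReal.ofReal σ = 1 + ENNReal.ofReal (σ - 1) := by
    rw [← ENNReal.ofReal_one, ← ENNReal.ofReal_add zero_le_one (by linarith)]
    congr 1
    ring
  rw [e, add_mul, one_mul] at key
  exact (ENNReal.add_le_add_iff_right (by finiteness)).1 key

/-- The control `e^{(l-K)t} m β^{-1/σ}`, which the feedback produces, turns the dual bound into an
equality. -/
theorem lintegral_utility_eq {ρ σ : ℝ} (hσ : 0 < σ) {N : Coeff} (hN : 0 ≤ N)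
    {β : X} {l K : ℝ} {c C : ℝ} (hc : 0 < c) (hβb : ∀ᵐ θ : S1, c ≤ β θ ∧ β θ ≤ C)
    (hKβ : ∫ θ, β θ ^ (1 - 1 / σ) * N θ = K) (hK : K * σ = ρ - l * (1 - σ)) (hK0 : 0 < K)
    {m : ℝ} (hm : 0 < m) {u : ℝ → X}
    (hu : ∀ t, 0 ≤ t → u t = (Real.exp ((l - K) * t) * m) • powL2 β (-1 / σ)) :
    ∫⁻ t in Ioi (0 : ℝ), ENNReal.ofReal (Real.exp (-ρ * t)) * powerIntegral σ N (u t)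
      = ENNReal.ofReal (m ^ (1 - σ)) := by
  calc _ = ∫⁻ t in Ioi (0 : ℝ), ENNReal.ofReal (m ^ (1 - σ))
        * ENNReal.ofReal (K * Real.exp (-K * t)) := by
        refine setLIntegral_congr_fun measurableSet_Ioi fun t ht => ?_
        have hE := (Real.exp_pos (-ρ * t)).le
        rw [hu t (le_of_lt ht), powerIntegral_smul_powL2 hσ hN hc hβb
          (mul_pos (Real.exp_pos _) hm), hKβ, ← mul_assoc, ← ENNReal.ofReal_mul hE,
          ← ENNReal.ofReal_mul (by positivity), ← ENNReal.ofReal_mul (by positivity)]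
        congr 1
        rw [Real.mul_rpow (Real.exp_pos _).le hm.le, ← Real.exp_mul]
        have e : Real.exp (-K * t) = Real.exp (-ρ * t) * Real.exp ((l - K) * t * (1 - σ)) := by
          rw [← Real.exp_add]
          congr 1
          linear_combination (-t) * hK
        rw [e]
        ring
    _ = _ := by
        rw [lintegral_const_mul' _ _ (by finiteness), lintegral_exp_decay hK0, mul_one]

/-! ### The closed loop equation and the value function -/

/-- The value of the capital stock along any mild solution of the closed loop equation. -/
theorem IsClosedLoopSolution.inner_eq {A N : Coeff} (hS : IsGeneratedSemigroup A (expA A))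
    {β g : X} {l K : ℝ} (hβ : OpGraph A β (l • β)) (hK : ⟪(N • g : X), β⟫_ℝ = K) {x : X}
    {z : ℝ → X} (hz : IsClosedLoopSolution A N (fun y => ⟪y, β⟫_ℝ • g) x z) {t : ℝ}
    (ht : 0 ≤ t) : ⟪z t, β⟫_ℝ = Real.exp ((l - K) * t) * ⟪x, β⟫_ℝ := by
  obtain ⟨hzc, hz⟩ := hz
  have hμc : ContinuousOn (fun t => ⟪z t, β⟫_ℝ) (Ici 0) := hzc.inner continuousOn_const
  have huc : ContinuousOn (fun t => ⟪z t, β⟫_ℝ • g) (Ici 0) := hμc.smul continuousOn_const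
  have hN : ∀ r, ⟪(N • (⟪z r, β⟫_ℝ • g) : X), β⟫_ℝ = K * ⟪z r, β⟫_ℝ := fun r => by
    rw [← Lp.smul_comm, real_inner_smul_left, hK, mul_comm]
  have key := eq_exp_of_integral_eq (m := fun t => Real.exp (-l * t) * ⟪z t, β⟫_ℝ)
    (m₀ := ⟪x, β⟫_ℝ) (l := -K)
    ((by fun_prop : Continuous fun t : ℝ => Real.exp (-l * t)).continuousOn.mul hμc)
    (fun t ht => ?_) ht
  · have h1 : ⟪z t, β⟫_ℝ = Real.exp (l * t) * (Real.exp (-l * t) * ⟪z t, β⟫_ℝ) := by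
      rw [← mul_assoc, ← Real.exp_add]
      simp
    rw [h1, key, ← mul_assoc, ← Real.exp_add]
    congr 2
    ring
  · have h1 : z t = traj A N x (fun r => ⟪z r, β⟫_ℝ • g) t := hz t ht
    have h2 := inner_traj (N := N) hS hβ x ht (intervalIntegrable_of_locallyIntegrableOn
      (huc.locallyIntegrableOn measurableSet_Ici) ht)
    rw [← h1] at h2
    rw [h2, ← mul_assoc, ← Real.exp_add]
    simp only [hN, neg_mul, neg_add_cancel, Real.exp_zero, one_mul]
    simp_rw [mul_left_comm _ K]
    rw [intervalIntegral.integral_const_mul, sub_eq_add_neg]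

/-- The feedback enters the closed loop equation only through `⟨y, β⟩`, which is determined by the
initial state; hence mild solutions are unique. -/
theorem IsClosedLoopSolution.eqOn {A N : Coeff} (hS : IsGeneratedSemigroup A (expA A))
    {β g : X} {l : ℝ} (hβ : OpGraph A β (l • β)) {x : X} {y z : ℝ → X}
    (hy : IsClosedLoopSolution A N (fun y => ⟪y, β⟫_ℝ • g) x y)
    (hz : IsClosedLoopSolution A N (fun y => ⟪y, β⟫_ℝ • g) x z) : EqOn z y (Ici 0) := by
  intro t ht
  rw [hz.2 t ht, hy.2 t ht]
  congr 1
  apply intervalIntegral.integral_congr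
  intro r hr
  rw [uIcc_of_le ht] at hr
  dsimp only
  rw [hz.inner_eq hS hβ rfl hr.1, hy.inner_eq hS hβ rfl hr.1]

/-- If `𝒜` generated no semigroup, then `expA A` would take its default value `0` and every mild
solution would vanish. -/
theorem IsClosedLoopSolution.isGeneratedSemigroup {A N : Coeff} {φ : X → X} {x : X} {y : ℝ → X}
    (h : IsClosedLoopSolution A N φ x y) {t : ℝ} (ht : 0 ≤ t) (hy : y t ≠ 0) :
    IsGeneratedSemigroup A (expA A) := by
  by_cases hex : ∃ S, IsGeneratedSemigroup A S
  · rw [expA, dif_pos hex]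
    exact hex.choose_spec
  · refine absurd ?_ hy
    have h1 : expA A = 0 := by rw [expA, dif_neg hex]
    rw [h.2 t ht, h1]
    simp

theorem smul_nonneg_of_nonneg {r : ℝ} {f : X} (hr : 0 ≤ r) (hf : 0 ≤ f) : 0 ≤ r • f := by
  refine (Lp.coeFn_nonneg _).1 ?_
  filter_upwards [Lp.coeFn_smul r f, ae_nonneg_of_nonneg hf] with θ h1 h2
  rw [h1]
  exact mul_nonneg hr h2

theorem isFeedbackMap_inner_smul {β g : X} (hβ : 0 ≤ β) (hg : 0 ≤ g) :
    IsFeedbackMap (fun y => ⟪y, β⟫_ℝ • g) := by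
  constructor
  · intro y hy
    exact smul_nonneg_of_nonneg (inner_nonneg_of_nonneg hy.1 hβ) hg
  · have hc : Continuous fun z : Xpos0 => ⟪(z : X), β⟫_ℝ • g :=
      (continuous_subtype_val.inner continuous_const).fun_smul continuous_const
    exact hc.borel_measurable

theorem objective_eq {ρ σ : ℝ} {N : Coeff} {u : ℝ → X} {V : ℝ} (hV : 0 ≤ V)
    (h : ∫⁻ t in Ioi (0 : ℝ), ENNReal.ofReal (Real.exp (-ρ * t)) * powerIntegral σ N (u t)
      = ENNReal.ofReal V) : objective ρ σ N u = ((V / (1 - σ) : ℝ) : EReal) := by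
  rw [objective, h, EReal.coe_ennreal_ofReal, max_eq_left hV, ← EReal.coe_mul, div_eq_inv_mul]

theorem objective_le_of_lt_one {ρ σ : ℝ} (hσ : σ < 1) {N : Coeff} {u : ℝ → X} {V : ℝ} (hV : 0 ≤ V)
    (h : ∫⁻ t in Ioi (0 : ℝ), ENNReal.ofReal (Real.exp (-ρ * t)) * powerIntegral σ N (u t)
      ≤ ENNReal.ofReal V) : objective ρ σ N u ≤ ((V / (1 - σ) : ℝ) : EReal) := by
  have h1 : (0 : EReal) ≤ (((1 - σ)⁻¹ : ℝ) : EReal) := by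
    exact_mod_cast inv_nonneg.2 (by linarith)
  have h2 := EReal.coe_ennreal_le_coe_ennreal_iff.2 h
  rw [EReal.coe_ennreal_ofReal, max_eq_left hV] at h2
  rw [objective, div_eq_inv_mul, EReal.coe_mul]
  exact mul_le_mul_of_nonneg_left h2 h1

theorem objective_le_of_one_lt {ρ σ : ℝ} (hσ : 1 < σ) {N : Coeff} {u : ℝ → X} {V : ℝ} (hV : 0 ≤ V)
    (h : ENNReal.ofReal V
      ≤ ∫⁻ t in Ioi (0 : ℝ), ENNReal.ofReal (Real.exp (-ρ * t)) * powerIntegral σ N (u t)) :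
    objective ρ σ N u ≤ ((V / (1 - σ) : ℝ) : EReal) := by
  have h1 : (0 : EReal) ≤ (((σ - 1)⁻¹ : ℝ) : EReal) := by
    exact_mod_cast inv_nonneg.2 (by linarith)
  have h2 := EReal.coe_ennreal_le_coe_ennreal_iff.2 h
  rw [EReal.coe_ennreal_ofReal, max_eq_left hV] at h2
  have e : (1 - σ)⁻¹ = -(σ - 1)⁻¹ := by rw [← inv_neg, neg_sub]
  rw [objective, div_eq_inv_mul, EReal.coe_mul, e, EReal.coe_neg, EReal.neg_mul, EReal.neg_mul,
    EReal.neg_le_neg_iff]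
  exact mul_le_mul_of_nonneg_left h2 h1

/-- The normalisation of `β`: with `β = α₀ e₀` one has `∫ β^{1-1/σ} N = (ρ - λ₀(1-σ))/σ`. -/
theorem integral_rpow_const_smul {σ D I a : ℝ} (hσ : 0 < σ) (hσ1 : σ ≠ 1) (hD : 0 < D)
    (hI : 0 < I) (ha : a = (σ / D * I) ^ (σ / (1 - σ))) {e : X} {N : Coeff} (he : 0 ≤ e)
    (hIe : ∫ θ, e θ ^ (1 - 1 / σ) * N θ = I) :
    ∫ θ, (a • e : X) θ ^ (1 - 1 / σ) * N θ = D / σ := by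
  have hb : 0 < σ / D * I := by positivity
  have ha0 : 0 < a := by rw [ha]; exact Real.rpow_pos_of_pos hb _
  have h1 : ∫ θ, (a • e : X) θ ^ (1 - 1 / σ) * N θ = a ^ (1 - 1 / σ) * I := by
    rw [← hIe, ← integral_const_mul]
    apply integral_congr_ae
    filter_upwards [Lp.coeFn_smul a e, ae_nonneg_of_nonneg he] with θ h1 h2
    rw [h1, Pi.smul_apply, smul_eq_mul, Real.mul_rpow ha0.le h2, mul_assoc]
  have hσ2 : 1 - σ ≠ 0 := sub_ne_zero.2 hσ1.symm
  have e1 : σ / (1 - σ) * (1 - 1 / σ) = -1 := by field_simp; ring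
  rw [h1, ha, ← Real.rpow_mul hb.le, e1, Real.rpow_neg_one]
  field_simp

end SpatialGrowth

end

open SpatialGrowth in
theorem mainTheorem5
    (ρ σ : ℝ) (hρ : 0 < ρ) (hσ : 0 < σ) (hσ1 : σ ≠ 1)
    (A N : Coeff) (hN : 0 ≤ N) (hN0 : N ≠ 0)
    (hρσ : lambda0 A * (1 - σ) < ρ)
    (e₀ : X) (he₀ : IsPrincipalEigenfunction A e₀) :
    (∀ᵐ θ : S1, 0 < beta ρ σ A N e₀ θ) ∧
    MemLp (fun θ => (beta ρ σ A N e₀ θ) ^ (-1 / σ)) 2 (volume : Measure S1) ∧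
    ∀ x ∈ Xpos0, ∀ y : ℝ → X,
      IsClosedLoopSolution A N (feedback ρ σ A N e₀) x y →
      (∀ t : ℝ, 0 ≤ t → y t ∈ Xpos0) →
        IsAdmissibleFeedback A N (feedback ρ σ A N e₀) x y ∧
        IsOptimalControl ρ σ A N x (fun t => feedback ρ σ A N e₀ (y t)) ∧
        IsOptimalFeedback ρ σ A N (feedback ρ σ A N e₀) x ∧
        valueFunction ρ σ A N x = ((explicitValue ρ σ A N e₀ x : ℝ) : EReal) := by
  have hD : 0 < ρ - lambda0 A * (1 - σ) := by linarith
  have he0 : e₀ ≠ 0 := by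
    rintro rfl
    have := he₀.norm_eq_one
    simp at this
  obtain ⟨c, C, hc, hcC⟩ := he₀.eigen.exists_bounds he₀.nonneg he0
  have hI := integral_rpow_mul_pos hc hcC (1 - 1 / σ) hN hN0
  have hα : 0 < alpha0 ρ σ A N e₀ := Real.rpow_pos_of_pos (by positivity) _
  have hKβ : ∫ θ, beta ρ σ A N e₀ θ ^ (1 - 1 / σ) * N θ = (ρ - lambda0 A * (1 - σ)) / σ :=
    integral_rpow_const_smul hσ hσ1 hD hI rfl he₀.nonneg rfl
  have hβb : ∀ᵐ θ : S1, alpha0 ρ σ A N e₀ * c ≤ beta ρ σ A N e₀ θ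
      ∧ beta ρ σ A N e₀ θ ≤ alpha0 ρ σ A N e₀ * C := by
    filter_upwards [Lp.coeFn_smul (alpha0 ρ σ A N e₀) e₀, hcC] with θ h1 h2
    rw [beta, h1, Pi.smul_apply, smul_eq_mul]
    exact ⟨by gcongr; exact h2.1, by gcongr; exact h2.2⟩
  have hβ : OpGraph A (beta ρ σ A N e₀) (lambda0 A • beta ρ σ A N e₀) := by
    have := he₀.eigen.smul (alpha0 ρ σ A N e₀)
    rwa [smul_comm] at this
  have hαc : 0 < alpha0 ρ σ A N e₀ * c := mul_pos hα hc
  have hβ0 : 0 ≤ beta ρ σ A N e₀ := smul_nonneg_of_nonneg hα.le he₀.nonneg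
  have hβpos : ∀ᵐ θ : S1, 0 < beta ρ σ A N e₀ θ := by
    filter_upwards [hβb] with θ h using hαc.trans_le h.1
  have hmem := memLp_rpow hαc hβb (-1 / σ) 2
  refine ⟨hβpos, hmem, fun x hx y hy hypos => ?_⟩
  set β : X := beta ρ σ A N e₀ with hβdef
  set g : X := powL2 β (-1 / σ) with hg
  have hφ : feedback ρ σ A N e₀ = fun y => ⟪y, β⟫_ℝ • g := rfl
  rw [hφ] at hy ⊢
  have hS := hy.isGeneratedSemigroup le_rfl (hypos 0 le_rfl).2
  have hx0 : 0 < ⟪x, β⟫_ℝ := inner_pos_of_mem_Xpos0 hx hβpos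
  have hK0 : 0 < (ρ - lambda0 A * (1 - σ)) / σ := by positivity
  have hK : (ρ - lambda0 A * (1 - σ)) / σ * σ = ρ - lambda0 A * (1 - σ) :=
    div_mul_cancel₀ _ hσ.ne'
  have hg0 : 0 ≤ g := by
    refine (Lp.coeFn_nonneg _).1 ?_
    filter_upwards [coeFn_powL2 hmem, hβpos] with θ h1 h2
    rw [hg, h1]
    exact Real.rpow_nonneg h2.le _
  have hfb := isFeedbackMap_inner_smul hβ0 hg0
  have hadm : (fun t => ⟪y t, β⟫_ℝ • g) ∈ Admissible A N x := by
    refine ⟨ContinuousOn.locallyIntegrableOn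
      ((hy.1.inner continuousOn_const).fun_smul continuousOn_const) measurableSet_Ici, ?_, ?_⟩
    · exact (ae_restrict_iff' measurableSet_Ici).2 (ae_of_all _ fun t ht => hfb.1 (hypos t ht))
    · intro t ht
      have : y t = traj A N x (fun t => ⟪y t, β⟫_ℝ • g) t := hy.2 t ht
      rw [← this]
      exact hypos t ht
  have hV : 0 ≤ ⟪x, β⟫_ℝ ^ (1 - σ) := Real.rpow_nonneg hx0.le _
  have hval : objective ρ σ N (fun t => ⟪y t, β⟫_ℝ • g)
      = ((explicitValue ρ σ A N e₀ x : ℝ) : EReal) :=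
    objective_eq hV (lintegral_utility_eq hσ hN hαc hβb hKβ hK hK0 hx0 fun t ht => by
      rw [hy.inner_eq hS hβ ((inner_coeff_smul_powL2 N hαc hβb).trans hKβ) ht])
  have hle : ∀ w ∈ Admissible A N x,
      objective ρ σ N w ≤ ((explicitValue ρ σ A N e₀ x : ℝ) : EReal) := by
    intro w hw
    rcases lt_or_gt_of_ne hσ1 with h1 | h1
    · exact objective_le_of_lt_one h1 hV
        (lintegral_utility_le hσ h1 hN hS hβ hβ0 hαc hβb hKβ hK hK0 hx0 hw)
    · exact objective_le_of_one_lt h1 hV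
        (le_lintegral_utility h1 hN hS hβ hβ0 hαc hβb hKβ hK hK0 hx0 hw)
  have hopt : IsOptimalControl ρ σ A N x (fun t => ⟪y t, β⟫_ℝ • g) :=
    ⟨hadm, fun w hw => by rw [hval]; exact hle w hw⟩
  have hfeed : IsAdmissibleFeedback A N (fun y => ⟪y, β⟫_ℝ • g) x y :=
    ⟨hfb, hy, fun z hz => hy.eqOn hS hβ hz, hypos, hadm⟩
  refine ⟨hfeed, hopt, ⟨y, hfeed, hopt⟩, le_antisymm (iSup₂_le hle) ?_⟩
  rw [← hval]
  exact le_iSup₂ (f := fun u (_ : u ∈ Admissible A N x) => objective ρ σ N u) _ hadm
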